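/- Let $z=(z_1,z_2,z_3)\in\mathbb C^3$, $w\in\mathbb C^7$, and let $M\subset\mathbb C^{10}$ be the quadric of real codimension $7$ given by $$\begin{aligned} \operatorname{Re}w_1&=z_1\bar z_1+z_2\bar z_2-z_3\bar z_3, & \operatorname{Re}w_2&=z_1\bar z_1-z_2\bar z_2, & \operatorname{Re}w_3&=z_2\bar z_3+z_3\bar z_2,\\ \operatorname{Re}w_4&=z_1\bar z_2+z_2\bar z_1, & \operatorname{Re}w_5&=iz_1\bar z_3-iz_3\bar z_1, & \operatorname{Re}w_6&=iz_2\bar z_3-iz_3\bar z_2,\\ \operatorname{Re}w_7&=iz_1\bar z_2-iz_2\bar z_1. \end{aligned}$$ Write the equations as $\operatorname{Re}w_j={}^t\bar z A_jz$ with Hermitian $3\times3$ matrices $A_1,\dots,A_7$, and put $r_j=\operatorname{Re}w_j-{}^t\bar zA_jz$. *Definitions.* $M$ is strongly pseudoconvex at $0$ if $\sum_j b_jA_j$ is positive definite for some $b\in\mathbb R^7$. It is $\mathfrak D$-nondegenerate at $0$ if there are $b\in\mathbb R^7$ with $\sum_jb_jA_j$ invertible and $V\in\mathbb C^3$ such that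 the real matrix $\operatorname{Re}\big({}^t\bar D(\sum_jb_jA_j)^{-1}D\big)$ is invertible, where $D$ is the matrix with columns $A_1V,\dots,A_7V$. Let $b\in\mathbb R^7$ with $\sum_j b_jA_j$ invertible. For $a\in\mathbb C^7$ put $P=\sum_ja_jA_j$ and $A=\sum_j(b_j-a_j-\bar a_j)A_j$, and let $X$ be the unique solution of $PX^2+AX+{}^t\bar P=0$ with operator norm $\|X\|<1$ (it exists if $a$ is small enough). $M$ is $\mathfrak D(a)$-nondegenerate at $0$ (relative to $b$) if there is $V\in\mathbb C^3$, called a witness, such that the real $7\times7$ matrix $\operatorname{Re}\big(\sum_{r\ge0}{}^t\bar V\,{}^t\bar X^rA_jA^{-1}A_sX^rV\big)_{j,s}$ is invertible. Let $\Delta$ be the open unit disc in $\mathbb C$. Let $\mathcal S_0(M)$ be the set, with the topology of uniform convergence, of continuous maps $\boldsymbol f=(f,\tilde f):\overline\Delta\to T^*\mathbb C^{10}=\mathbb C^{10}\times\mathbb C^{10}$, holomorphic in $\Delta$, such that $f$ is nonconstant, $f(\partial\Delta)\subset M$, for some functions $c_1,\dots,c_7:\partial\Delta\to\mathbb R$ one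 has $\sum_jc_j(\zeta)\partial r_j(0)\ne0$ and $\tilde f(\zeta)=\zeta\sum_jc_j(\zeta)\,\partial r_j(f(\zeta))$ for all $\zeta\in\partial\Delta$, and $\boldsymbol f(1)=(0,0,0,b/2)$. The lift parametrized by $(a,V)\in\mathbb C^7\times\mathbb C^3$ is the element $(h,g,\tilde h,\tilde g)$ of $\mathcal S_0(M)$ with $h(\zeta)=(1-\zeta)(I-\zeta X)^{-1}(I-X)V$ and $\tilde g_j(\zeta)=\frac12\big(a_j+(b_j-a_j-\bar a_j)\zeta+\bar a_j\zeta^2\big)$. The $1$-jet map is $\mathfrak j_1:\mathcal S_0(M)\ni\boldsymbol f\mapsto\boldsymbol f'(1)$; its values are identified with points of $\mathbb C^3\times\mathbb R^7\times\mathbb R^7$ through the injection $(v,t,s)\mapsto\big(v,\,t,\,{}^t\bar v\sum_jb_jA_j,\,\tfrac b2+is\big)$. **Theorem.** $M$ is neither strongly pseudoconvex nor $\mathfrak D$-nondegenerate at $0$. There is $\varepsilon_0>0$ such that for every real $\varepsilon$ with $0<|\varepsilon|<\varepsilon_0$, with $a=(\varepsilon,\varepsilon,0,0,0,0,0)$,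 $b=(1+2\varepsilon,2\varepsilon,0,0,0,0,0)$ (so that $A=A_1$) and $V=(1,1,1)$: (i) $M$ is $\mathfrak D(a)$-nondegenerate at $0$, with witness $V$; (ii) the $1$-jet map $\mathfrak j_1$ on $\mathcal S_0(M)$ is a local diffeomorphism at the lift parametrized by $(a,V)$; that is, the parameters give a homeomorphism from an open neighbourhood of $(a,V)$ in $\mathbb C^7\times\mathbb C^3$ onto an open subset of $\mathcal S_0(M)$, the lifts in this set are differentiable at $\zeta=1$ with derivative in the image of the above injection, and in these parameters $\mathfrak j_1$, as a map into $\mathbb C^3\times\mathbb R^7\times\mathbb R^7$, is a $\mathcal C^\infty$ local diffeomorphism at $(a,V)$. -/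

import Mathlib

open scoped Matrix

noncomputable section

/-- The space `ℂⁿ × ℂᵈ = ℂⁿ⁺ᵈ` with coordinates `(z, w)`. It also serves for its cotangent
spaces, a covector being given by its coefficients with respect to `dz₁, …, dzₙ, dw₁, …, dw_d`. -/
abbrev CRSpace (n d : ℕ) : Type := (Fin n → ℂ) × (Fin d → ℂ)

/-- The quadric `Re w_j = ᵗz̄ A_j z`, `j = 1, …, d` (the right-hand side is real when `A_j` is
Hermitian). -/
def quadric {n d : ℕ} (A : Fin d → Matrix (Fin n) (Fin n) ℂ) : Set (CRSpace n d) :=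
  {p | ∀ j, (p.2 j).re = (star p.1 ⬝ᵥ A j *ᵥ p.1).re}

/-- The real-linear combination `∑ b_j A_j`. -/
def pencil {n d : ℕ} (A : Fin d → Matrix (Fin n) (Fin n) ℂ) (b : Fin d → ℝ) :
    Matrix (Fin n) (Fin n) ℂ :=
  ∑ j, (b j : ℂ) • A j

/-! ### Nondegeneracy conditions at the origin -/

open scoped ComplexOrder in
/-- Strong pseudoconvexity at `0`: some real combination of the `A_j` is positive definite. -/
def IsStronglyPseudoconvex {n d : ℕ} (A : Fin d → Matrix (Fin n) (Fin n) ℂ) : Prop :=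
  ∃ b : Fin d → ℝ, (pencil A b).PosDef

/-- The `n × d` matrix whose `j`-th column is `A_j V`. -/
def columnMatrix {n d : ℕ} (A : Fin d → Matrix (Fin n) (Fin n) ℂ) (V : Fin n → ℂ) :
    Matrix (Fin n) (Fin d) ℂ :=
  Matrix.of fun i j => (A j *ᵥ V) i

/-- `𝔇`-nondegeneracy at `0`: for some `b` with `∑ b_j A_j` invertible and some `V`, the real
matrix `Re (ᵗD̄ (∑ b_j A_j)⁻¹ D)` is invertible, where `D` has columns `A_j V`. -/
def IsDNondegenerate {n d : ℕ} (A : Fin d → Matrix (Fin n) (Fin n) ℂ) : Prop :=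
  ∃ b : Fin d → ℝ, IsUnit (pencil A b) ∧ ∃ V : Fin n → ℂ,
    IsUnit (((columnMatrix A V)ᴴ * (pencil A b)⁻¹ * columnMatrix A V).map Complex.re)

/-- `P = ∑ a_j A_j`. -/
def coeffP {n d : ℕ} (A : Fin d → Matrix (Fin n) (Fin n) ℂ) (a : Fin d → ℂ) :
    Matrix (Fin n) (Fin n) ℂ :=
  ∑ j, a j • A j

/-- `∑ (b_j - a_j - ā_j) A_j`. -/
def coeffA {n d : ℕ} (A : Fin d → Matrix (Fin n) (Fin n) ℂ) (b : Fin d → ℝ) (a : Fin d → ℂ) :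
    Matrix (Fin n) (Fin n) ℂ :=
  ∑ j, ((b j : ℂ) - a j - star (a j)) • A j

open scoped Matrix.Norms.L2Operator in
/-- `X` is the unique solution of `P X² + A X + ᵗP̄ = 0` with operator norm `‖X‖ < 1`. -/
def IsSmallSolution {n d : ℕ} (A : Fin d → Matrix (Fin n) (Fin n) ℂ) (b : Fin d → ℝ)
    (a : Fin d → ℂ) (X : Matrix (Fin n) (Fin n) ℂ) : Prop :=
  (coeffP A a * X ^ 2 + coeffA A b a * X + (coeffP A a)ᴴ = 0 ∧ ‖X‖ < 1) ∧
    ∀ Y : Matrix (Fin n) (Fin n) ℂ,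
      coeffP A a * Y ^ 2 + coeffA A b a * Y + (coeffP A a)ᴴ = 0 → ‖Y‖ < 1 → Y = X

/-- The `d × d` real matrix `Re (∑_r ᵗV̄ ᵗX̄ʳ A_j A⁻¹ A_s Xʳ V)_{j,s}`. -/
def DaMatrix {n d : ℕ} (A : Fin d → Matrix (Fin n) (Fin n) ℂ) (b : Fin d → ℝ)
    (a : Fin d → ℂ) (X : Matrix (Fin n) (Fin n) ℂ) (V : Fin n → ℂ) :
    Matrix (Fin d) (Fin d) ℝ :=
  Matrix.of fun j s =>
    (∑' r : ℕ, star (X ^ r *ᵥ V) ⬝ᵥ (A j * (coeffA A b a)⁻¹ * A s) *ᵥ (X ^ r *ᵥ V)).re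

/-- `V` witnesses the `𝔇(a)`-nondegeneracy at `0` (relative to `b`, with `∑ b_j A_j` invertible). -/
def IsDaNondegenerateAt {n d : ℕ} (A : Fin d → Matrix (Fin n) (Fin n) ℂ) (b : Fin d → ℝ)
    (a : Fin d → ℂ) (V : Fin n → ℂ) : Prop :=
  IsUnit (pencil A b) ∧ IsUnit (coeffA A b a) ∧
    ∃ X, IsSmallSolution A b a X ∧ IsUnit (DaMatrix A b a X V)

/-- `𝔇(a)`-nondegeneracy at `0`, relative to `b`. -/
def IsDaNondegenerate {n d : ℕ} (A : Fin d → Matrix (Fin n) (Fin n) ℂ) (b : Fin d → ℝ)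
    (a : Fin d → ℂ) : Prop :=
  ∃ V : Fin n → ℂ, IsDaNondegenerateAt A b a V

/-! ### Lifts of stationary discs -/

/-- The defining function `r_j = Re w_j - ᵗz̄ A_j z`. -/
def definingFun {n d : ℕ} (A : Fin d → Matrix (Fin n) (Fin n) ℂ) (j : Fin d)
    (p : CRSpace n d) : ℝ :=
  (p.2 j).re - (star p.1 ⬝ᵥ A j *ᵥ p.1).re

/-- The Wirtinger derivative `½ (D_v φ - i D_{iv} φ)` of a real-valued function. -/
def wirtinger {n d : ℕ} (φ : CRSpace n d → ℝ) (p v : CRSpace n d) : ℂ :=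
  (1 / 2 : ℂ) *
    ((fderiv ℝ φ p v : ℝ) - Complex.I * (fderiv ℝ φ p (Complex.I • v) : ℝ))

/-- The covector `∂r_j = ∑ ∂r_j/∂z_k dz_k + ∑ ∂r_j/∂w_k dw_k` at `p`. -/
def delR {n d : ℕ} (A : Fin d → Matrix (Fin n) (Fin n) ℂ) (j : Fin d) (p : CRSpace n d) :
    CRSpace n d :=
  (fun k => wirtinger (definingFun A j) p (Pi.single k 1, 0),
   fun k => wirtinger (definingFun A j) p (0, Pi.single k 1))

/-- For Hermitian `A_j`, `∂r_j = -ᵗz̄ A_j dz + ½ dw_j`. -/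
theorem delR_eq {n d : ℕ} (A : Fin d → Matrix (Fin n) (Fin n) ℂ) (j : Fin d)
    (hA : (A j).IsHermitian) (p : CRSpace n d) :
    delR A j p = (-(star p.1 ᵥ* A j), Pi.single j (1 / 2)) := by
  have key : ∀ v : CRSpace n d, fderiv ℝ (definingFun A j) p v =
      (v.2 j).re - 2 * (star p.1 ⬝ᵥ A j *ᵥ v.1).re := by
    intro v
    have hlin : HasDerivAt (fun t : ℝ => p + t • v) v 0 := by
      simpa using ((hasDerivAt_id (0 : ℝ)).smul_const v).const_add p
    have hdiff : DifferentiableAt ℝ (definingFun A j) p := by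
      have : Differentiable ℝ (definingFun A j) := by
        have h1 : ∀ i, Differentiable ℝ fun q : CRSpace n d => star (q.1 i) := fun i => by
          have : Differentiable ℝ fun q : CRSpace n d => q.1 i := by fun_prop
          exact (Complex.conjCLE.differentiable).comp this
        have h2 : Differentiable ℝ fun q : CRSpace n d =>
            q.2 j - ∑ i, star (q.1 i) * ∑ k, A j i k * q.1 k := by fun_prop
        have h3 := (Complex.reCLM.differentiable).comp h2
        exact h3
      exact this p
    have hc : HasDerivAt (fun t : ℝ => definingFun A j (p + t • v))
        (fderiv ℝ (definingFun A j) p v) 0 := by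
      have := hdiff.hasFDerivAt
      have h' : HasFDerivAt (definingFun A j) (fderiv ℝ (definingFun A j) p) (p + (0 : ℝ) • v) := by
        simpa using this
      exact h'.comp_hasDerivAt 0 hlin
    have hsymm : (star v.1 ⬝ᵥ A j *ᵥ p.1).re = (star p.1 ⬝ᵥ A j *ᵥ v.1).re := by
      have : star (star v.1 ⬝ᵥ A j *ᵥ p.1) = star p.1 ⬝ᵥ A j *ᵥ v.1 := by
        rw [Matrix.star_dotProduct, star_star, Matrix.star_mulVec, hA.eq, Matrix.dotProduct_mulVec,
          dotProduct_comm]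
      rw [← this]
      simp
    have hexp : (fun t : ℝ => definingFun A j (p + t • v)) = fun t : ℝ =>
        definingFun A j p + t * ((v.2 j).re - 2 * (star p.1 ⬝ᵥ A j *ᵥ v.1).re)
          - t ^ 2 * (star v.1 ⬝ᵥ A j *ᵥ v.1).re := by
      funext t
      have hst : star (t • v.1) = t • star v.1 := by
        ext i; simp
      simp only [definingFun, Prod.fst_add, Prod.snd_add, Prod.smul_fst, Prod.smul_snd, star_add,
        hst, Matrix.mulVec_add, Matrix.mulVec_smul, add_dotProduct, dotProduct_add,
        smul_dotProduct, dotProduct_smul, Complex.add_re, Complex.smul_re, Pi.add_apply,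
        Pi.smul_apply, smul_eq_mul, hsymm]
      ring
    have hd : HasDerivAt (fun t : ℝ => definingFun A j (p + t • v))
        ((v.2 j).re - 2 * (star p.1 ⬝ᵥ A j *ᵥ v.1).re) 0 := by
      rw [hexp]
      have h1 := (((hasDerivAt_id (0 : ℝ)).mul_const
        ((v.2 j).re - 2 * (star p.1 ⬝ᵥ A j *ᵥ v.1).re)).const_add (definingFun A j p)).sub
        (((hasDerivAt_id (0 : ℝ)).pow 2).mul_const (star v.1 ⬝ᵥ A j *ᵥ v.1).re)
      exact h1.congr_deriv (by simp)
    exact hc.unique hd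
  refine Prod.ext (funext fun k => ?_) (funext fun k => ?_)
  · simp only [delR, wirtinger, key]
    simp only [Prod.smul_fst, Prod.smul_snd, Matrix.mulVec_smul, dotProduct_smul]
    rw [Matrix.dotProduct_mulVec, dotProduct_single_one]
    apply Complex.ext <;> simp
  · simp only [delR, wirtinger, key]
    by_cases h : k = j
    · subst h
      apply Complex.ext <;> simp
    · simp [h, Ne.symm h]

/-- Continuous maps `𝐟 = (f, f̃)` from the closed unit disc to `T*ℂⁿ⁺ᵈ`, with the topology of
uniform convergence. -/
abbrev DiscMap (n d : ℕ) : Type :=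
  C(Metric.closedBall (0 : ℂ) 1, CRSpace n d × CRSpace n d)

open Classical in
/-- Extension by `0` of a map on the closed disc; only its values on the closed disc are used. -/
def discExtend {n d : ℕ} (F : DiscMap n d) (ζ : ℂ) : CRSpace n d × CRSpace n d :=
  if h : ζ ∈ Metric.closedBall (0 : ℂ) 1 then F ⟨ζ, h⟩ else 0

/-- The set `𝒮(M)` of holomorphic lifts `𝐟 = (f, f̃)` of nonconstant stationary discs `f` of the
quadric: `f(∂Δ) ⊂ M` and, on `∂Δ`, `f̃(ζ) = ζ ∑ c_j(ζ) ∂r_j(f(ζ))` with real functions `c_j` such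
that `∑ c_j(ζ) ∂r_j(0) ≠ 0`. -/
def stationaryLifts {n d : ℕ} (A : Fin d → Matrix (Fin n) (Fin n) ℂ) : Set (DiscMap n d) :=
  {F | DifferentiableOn ℂ (discExtend F) (Metric.ball 0 1) ∧
    (¬ ∃ p, ∀ ζ, (F ζ).1 = p) ∧
    (∀ ζ : Metric.closedBall (0 : ℂ) 1, ‖(ζ : ℂ)‖ = 1 → (F ζ).1 ∈ quadric A) ∧
    ∃ c : Fin d → ℂ → ℝ, ∀ ζ : Metric.closedBall (0 : ℂ) 1, ‖(ζ : ℂ)‖ = 1 →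
      ∑ j, c j ζ • delR A j 0 ≠ 0 ∧
      (F ζ).2 = (ζ : ℂ) • ∑ j, c j ζ • delR A j (F ζ).1}

/-- The set `𝒮₀(M)` of lifts whose value at `ζ = 1` is `(0, 0, 0, b/2)`, with the topology of
uniform convergence on the closed disc. -/
def pointedLifts {n d : ℕ} (A : Fin d → Matrix (Fin n) (Fin n) ℂ) (b : Fin d → ℝ) :
    Set (DiscMap n d) :=
  {F | F ∈ stationaryLifts A ∧
    discExtend F 1 = ((0, 0), (0, fun j => (b j : ℂ) / 2))}

/-- The lift `𝐟 = (h, g, h̃, g̃)` of `𝒮₀(M)` has parameters `(a, V)`: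
`h(ζ) = (1 - ζ) (I - ζX)⁻¹ (I - X) V`, where `X` is the small solution of the matrix equation, and
`g̃_j(ζ) = ζ c_j(ζ) / 2` with `c_j(ζ) = a_j ζ̄ + (b_j - a_j - ā_j) + ā_j ζ` on the unit circle.
The components `g` and `h̃` are then determined by membership in `𝒮₀(M)`. -/
def HasParameters {n d : ℕ} (A : Fin d → Matrix (Fin n) (Fin n) ℂ) (b : Fin d → ℝ)
    (F : DiscMap n d) (q : (Fin d → ℂ) × (Fin n → ℂ)) : Prop :=
  ∃ X, IsSmallSolution A b q.1 X ∧ ∀ ζ : Metric.closedBall (0 : ℂ) 1,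
    (F ζ).1.1 = (1 - (ζ : ℂ)) • ((1 - (ζ : ℂ) • X)⁻¹ *ᵥ ((1 - X) *ᵥ q.2)) ∧
    ∀ j, (F ζ).2.2 j =
      (q.1 j + ((b j : ℂ) - q.1 j - star (q.1 j)) * ζ + star (q.1 j) * (ζ : ℂ) ^ 2) / 2

/-- The real-affine injection `(v, t, s) ↦ (v, t, ᵗv̄ ∑ b_j A_j, b/2 + i s)` of `ℂⁿ × ℝᵈ × ℝᵈ` into
`T*ℂⁿ⁺ᵈ`, through which the derivatives `𝐟'(1)`, `𝐟 ∈ 𝒮₀(M)`, are identified with points of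
`ℂⁿ × ℝᵈ × ℝᵈ`. -/
def jetInclusion {n d : ℕ} (A : Fin d → Matrix (Fin n) (Fin n) ℂ) (b : Fin d → ℝ)
    (y : (Fin n → ℂ) × (Fin d → ℝ) × (Fin d → ℝ)) : CRSpace n d × CRSpace n d :=
  ((y.1, fun j => (y.2.1 j : ℂ)),
   (star y.1 ᵥ* pencil A b, fun j => (b j : ℂ) / 2 + Complex.I * (y.2.2 j : ℂ)))

open scoped Manifold ContDiff in
/-- The `1`-jet map `𝔧₁ : 𝐟 ↦ 𝐟'(1)` on `𝒮₀(M)` is a local diffeomorphism at the lift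
parametrized by `q₀ = (a, V)`: the parameters `(a, V)` form a chart `e` of `𝒮₀(M)` around that
lift (a homeomorphism of an open set of parameters onto an open subset of `𝒮₀(M)`), and in this
chart `𝔧₁`, with values identified with points of `ℂⁿ × ℝᵈ × ℝᵈ`, is a local diffeomorphism at
`q₀`. -/
def OneJetIsLocalDiffeoAt {n d : ℕ} (A : Fin d → Matrix (Fin n) (Fin n) ℂ) (b : Fin d → ℝ)
    (q₀ : (Fin d → ℂ) × (Fin n → ℂ)) : Prop :=
  ∃ e : OpenPartialHomeomorph ((Fin d → ℂ) × (Fin n → ℂ)) (pointedLifts A b),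
    q₀ ∈ e.source ∧
    (∀ q ∈ e.source, HasParameters A b (e q : DiscMap n d) q) ∧
    ∃ Ψ : (Fin d → ℂ) × (Fin n → ℂ) → (Fin n → ℂ) × (Fin d → ℝ) × (Fin d → ℝ),
      (∀ q ∈ e.source, HasDerivWithinAt (discExtend (e q : DiscMap n d))
        (jetInclusion A b (Ψ q)) (Metric.closedBall 0 1) 1) ∧
      IsLocalDiffeomorphAt 𝓘(ℝ, (Fin d → ℂ) × (Fin n → ℂ))
        𝓘(ℝ, (Fin n → ℂ) × (Fin d → ℝ) × (Fin d → ℝ)) ∞ Ψ q₀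

/-! ### The example -/

/-- The matrices `A_1, …, A_7` of the seven Hermitian forms, written as `ᵗz̄ A_j z`. -/
def exampleForms : Fin 7 → Matrix (Fin 3) (Fin 3) ℂ :=
  ![!![1, 0, 0; 0, 1, 0; 0, 0, -1],
    !![1, 0, 0; 0, -1, 0; 0, 0, 0],
    !![0, 0, 0; 0, 0, 1; 0, 1, 0],
    !![0, 1, 0; 1, 0, 0; 0, 0, 0],
    !![0, 0, -Complex.I; 0, 0, 0; Complex.I, 0, 0],
    !![0, 0, 0; 0, 0, -Complex.I; 0, Complex.I, 0],
    !![0, -Complex.I, 0; Complex.I, 0, 0; 0, 0, 0]]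

/-- The submanifold of `ℂ¹⁰` under study, by its seven equations (both sides in `ℂ`). -/
theorem mem_quadric_exampleForms (z : Fin 3 → ℂ) (w : Fin 7 → ℂ) :
    (z, w) ∈ quadric exampleForms ↔
      ((w 0).re : ℂ) = z 0 * star (z 0) + z 1 * star (z 1) - z 2 * star (z 2) ∧
      ((w 1).re : ℂ) = z 0 * star (z 0) - z 1 * star (z 1) ∧
      ((w 2).re : ℂ) = z 1 * star (z 2) + z 2 * star (z 1) ∧
      ((w 3).re : ℂ) = z 0 * star (z 1) + z 1 * star (z 0) ∧
      ((w 4).re : ℂ) = Complex.I * z 0 * star (z 2) - Complex.I * z 2 * star (z 0) ∧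
      ((w 5).re : ℂ) = Complex.I * z 1 * star (z 2) - Complex.I * z 2 * star (z 1) ∧
      ((w 6).re : ℂ) = Complex.I * z 0 * star (z 1) - Complex.I * z 1 * star (z 0) := by
  simp only [quadric, Set.mem_ofPred_eq, Fin.forall_fin_succ, IsEmpty.forall_iff, and_true]
  simp [exampleForms, dotProduct, Matrix.mulVec, Fin.sum_univ_three, Complex.ext_iff]
  grind

end

/-! On the unit circle the symbol `∑ c_j(ζ) A_j` of a lift is `ζ̄P + A + ζP*`. The small solution
`X` gives its Wiener–Hopf factorization `(1 - ζX)* Q (1 - ζX)`, with `Q = A + PX` Hermitian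
(`symbol_factorization`). What is needed about `X` comes from one contraction: since `‖X‖ < 1`, the
Stein operator `Z ↦ Z - X* Z X` is bijective. If `Q` is invertible, this makes `X` unique, and the
solutions `K_j = ∑ X*ʳ A_j Xʳ` of the Stein equations give `g` in closed form. Conversely, the
boundary conditions of a lift force `g̃` to be quadratic and `Q(1 - ζX)h` to be affine, so a lift
with regular `X` is one of the explicit ones (`pointedLifts_fst_fst`). The implicit function theorem
makes `X` and `K_j` analytic in `a`. Hence `(a, V)` is a chart.

In this chart the jet is `(-V, -2 W* K_j W, -Im a)` with `W = (1 - X)V`. A kernel vector of its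
derivative is a real variation `α` of `a`. By `deriv_quadratic_eq`, `W* K_j W` then has derivative
`2 Re U* G U`, where `U = (1 - X)² V` and `G - X* G X = K_j Q⁻¹ ∑ α_s K_s`. So (ii) reduces to the
nonsingularity of a matrix of the same type as in (i), with `K_j`, `Q`, `U` in place of `A_j`, `A`,
`V`.

In the example `X = diag(x, 0, y)` with `x = ρy` and `ρ → 2`. Both matrices become `gramPairing`,
with weights `U_k U_l / (1 - x_k x_l) = U_k U_l (1 + y² θ_kl)`. At `y = 0` the pairing is
degenerate: for real `U` the four real forms send `U` into `ℝ³`, and the three imaginary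
antisymmetric ones send it into `i U^⊥`, so each family satisfies a linear relation. The
corresponding combinations of rows are divisible by `y²`. After division, the two blocks have
nonzero determinant in the limit, hence for all small `ε ≠ 0`
(`eventually_gramPairing_nondegenerate`).

The two negative statements are elementary: a linear relation between the diagonal entries of the
pencil, and the dimension count `7 > 2 · 3`. -/

/-! ### Boundary uniqueness on the unit disc -/

open Metric in
/-- A holomorphic function whose boundary values are real is constant. -/
theorem DiffContOnCl.eq_zero_value_of_im_eq_zero {f : ℂ → ℂ}
    (hf : DiffContOnCl ℂ f (ball 0 1)) (h : ∀ ζ : ℂ, ‖ζ‖ = 1 → (f ζ).im = 0) {ζ : ℂ}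
    (hζ : ζ ∈ closedBall (0 : ℂ) 1) : f ζ = f 0 := by
  have hfr : frontier (ball (0 : ℂ) 1) = sphere 0 1 := frontier_ball _ one_ne_zero
  have hcl : closure (ball (0 : ℂ) 1) = closedBall 0 1 := closure_ball _ one_ne_zero
  -- For `c = ±i` the function `exp(c f)` has modulus `1` on the circle. The maximum principle
  -- bounds `Re (c f)`, and the two signs give `Im f = 0` on the disc.
  have bound : ∀ c : ℂ, (∀ w : ℂ, w.im = 0 → (c * w).re = 0) → ∀ z ∈ closedBall (0 : ℂ) 1,
      (c * f z).re ≤ 0 := by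
    intro c hc z hz
    have hd : DiffContOnCl ℂ (fun z => Complex.exp (c * f z)) (ball 0 1) :=
      Complex.differentiable_exp.comp_diffContOnCl (hf.const_smul c)
    have := Complex.norm_le_of_forall_mem_frontier_norm_le isBounded_ball hd (C := 1)
      (fun w hw => by
        rw [hfr, mem_sphere_zero_iff_norm] at hw
        simp [Complex.norm_exp, hc _ (h w hw)]) (z := z) (by rwa [hcl])
    simpa [Complex.norm_exp] using this
  have him : ∀ z ∈ closedBall (0 : ℂ) 1, (f z).im = 0 := by
    intro z hz
    have h1 := bound Complex.I (by simp) z hz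
    have h2 := bound (-Complex.I) (by simp) z hz
    simp at h1 h2
    linarith
  have key : ∀ z ∈ ball (0 : ℂ) 1, f z = f 0 := by
    intro z hz
    -- By the open mapping theorem a nonconstant `f` would have open image, which cannot lie in the
    -- real line.
    rcases (hf.differentiableOn.analyticOnNhd isOpen_ball).is_constant_or_isOpen
      (convex_ball (0 : ℂ) 1).isPreconnected with ⟨w, hw⟩ | ho
    · rw [hw z hz, hw 0 (by simp)]
    · exfalso
      have hopen := ho (ball 0 1) subset_rfl isOpen_ball
      obtain ⟨r, hr, hsub⟩ := Metric.isOpen_iff.1 hopen (f 0) ⟨0, by simp, rfl⟩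
      have : f 0 + (r / 2 : ℝ) * Complex.I ∈ ball (f 0) r := by
        rw [mem_ball, dist_eq_norm]
        simp [abs_of_pos hr]
        linarith
      obtain ⟨z, hz, hzr⟩ := hsub this
      have h1 := congrArg Complex.im hzr
      rw [him z (ball_subset_closedBall hz)] at h1
      simp [him 0 (by simp)] at h1
      linarith
  rw [← hcl] at hζ
  exact (Set.EqOn.of_subset_closure (f := f) (g := fun _ => f 0) key
    (hf.continuousOn) continuousOn_const subset_closure subset_rfl) hζ

open Metric in
/-- If `f = ḡ` on the unit circle, with `f` and `g` holomorphic, then `f` is constant. -/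
theorem DiffContOnCl.eq_zero_value_of_eq_star {f g : ℂ → ℂ}
    (hf : DiffContOnCl ℂ f (ball 0 1)) (hg : DiffContOnCl ℂ g (ball 0 1))
    (h : ∀ ζ : ℂ, ‖ζ‖ = 1 → f ζ = star (g ζ)) {ζ : ℂ}
    (hζ : ζ ∈ closedBall (0 : ℂ) 1) : f ζ = f 0 := by
  -- Both `f + g` and `i(f - g)` are real on the circle.
  have h1 := (hf.add hg).eq_zero_value_of_im_eq_zero (fun z hz => by simp [h z hz]) hζ
  have h2 := ((hf.sub hg).const_smul Complex.I).eq_zero_value_of_im_eq_zero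
    (fun z hz => by simp [h z hz]) hζ
  simp only [Pi.add_apply, Pi.smul_apply, Pi.sub_apply, smul_eq_mul] at h1 h2
  have h3 := mul_left_cancel₀ Complex.I_ne_zero h2
  linear_combination (h1 + h3) / 2

open Metric in
theorem DiffContOnCl.dslope_zero {f : ℂ → ℂ} (hf : DiffContOnCl ℂ f (ball 0 1)) :
    DiffContOnCl ℂ (dslope f 0) (ball 0 1) := by
  have hb : ball (0 : ℂ) 1 ∈ nhds 0 := ball_mem_nhds _ one_pos
  refine ⟨(Complex.differentiableOn_dslope hb).2 hf.differentiableOn, ?_⟩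
  exact (continuousOn_dslope (Filter.mem_of_superset hb subset_closure)).2
    ⟨hf.continuousOn, hf.differentiableOn.differentiableAt hb⟩

theorem eq_add_mul_dslope_zero (f : ℂ → ℂ) (ζ : ℂ) : f ζ = f 0 + ζ * dslope f 0 ζ := by
  have := sub_smul_dslope f 0 ζ
  simp only [sub_zero, smul_eq_mul] at this
  rw [this]; ring

theorem mul_star_eq_one_of_norm_eq_one {ζ : ℂ} (h : ‖ζ‖ = 1) : ζ * star ζ = 1 := by
  have := Complex.mul_conj' ζ
  simpa [h] using this

open Metric in
/-- If `u = ζ l̄` on the unit circle, with `u` and `l` holomorphic, then `u` is affine. -/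
theorem DiffContOnCl.eq_affine_of_eq_mul_star {u l : ℂ → ℂ}
    (hu : DiffContOnCl ℂ u (ball 0 1)) (hl : DiffContOnCl ℂ l (ball 0 1))
    (h : ∀ ζ : ℂ, ‖ζ‖ = 1 → u ζ = ζ * star (l ζ)) {ζ : ℂ}
    (hζ : ζ ∈ closedBall (0 : ℂ) 1) : u ζ = u 0 + ζ * (u 1 - u 0) := by
  have hid : DiffContOnCl ℂ (fun z : ℂ => star (u 0) * z) (ball 0 1) :=
    (differentiable_id.const_mul _).diffContOnCl
  -- On the circle `(u - u(0))/ζ = l̄ - u(0) ζ̄`, the conjugate of a holomorphic function, so the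
  -- quotient is constant.
  have hc : ∀ z : ℂ, ‖z‖ = 1 → dslope u 0 z = star ((l - fun z => star (u 0) * z) z) := by
    intro z hz
    have h1 := mul_star_eq_one_of_norm_eq_one hz
    have h2 := eq_add_mul_dslope_zero u z
    have h3 := h z hz
    simp only [Pi.sub_apply, star_sub, star_mul', star_star]
    linear_combination (star z) * (h3 - h2) + (star (l z) - dslope u 0 z) * h1
  have key := fun z hz => hu.dslope_zero.eq_zero_value_of_eq_star (hl.sub hid) hc (ζ := z) hz
  rw [eq_add_mul_dslope_zero u ζ, key ζ hζ, eq_add_mul_dslope_zero u 1, key 1 (by simp)]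
  ring

open Metric in
/-- If `u = ζ c` on the unit circle, with `u` holomorphic and `c` real, then `u` is a
self-reciprocal quadratic polynomial. -/
theorem DiffContOnCl.eq_quadratic_of_eq_mul_real {u : ℂ → ℂ} {c : ℂ → ℝ}
    (hu : DiffContOnCl ℂ u (ball 0 1)) (h : ∀ ζ : ℂ, ‖ζ‖ = 1 → u ζ = ζ * c ζ) {ζ : ℂ}
    (hζ : ζ ∈ closedBall (0 : ℂ) 1) :
    u ζ = u 0 + (u 1 - u 0 - star (u 0)) * ζ + star (u 0) * ζ ^ 2 := by
  have hid : DiffContOnCl ℂ (fun z : ℂ => star (u 0) * z) (ball 0 1) :=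
    (differentiable_id.const_mul _).diffContOnCl
  have hk := hu.dslope_zero.sub hid
  -- On the circle `(u - u(0))/ζ = c - u(0) ζ̄`; subtracting the conjugate term as well leaves a
  -- real function that extends holomorphically.
  have hc : ∀ z : ℂ, ‖z‖ = 1 → (dslope u 0 - fun z => star (u 0) * z) z =
      star ((dslope u 0 - fun z => star (u 0) * z) z) := by
    intro z hz
    have h1 := mul_star_eq_one_of_norm_eq_one hz
    have h2 := eq_add_mul_dslope_zero u z
    have h3 := h z hz
    have h4 : dslope u 0 z = c z - star z * u 0 := by
      linear_combination (star z) * (h3 - h2) + (c z - dslope u 0 z) * h1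
    simp only [Pi.sub_apply, star_sub, star_mul', star_star, h4]
    simp
    ring
  have key := fun z hz => hk.eq_zero_value_of_eq_star hk hc (ζ := z) hz
  have k1 := key ζ hζ
  have k2 := key 1 (by simp)
  simp only [Pi.sub_apply] at k1 k2
  have e1 := eq_add_mul_dslope_zero u ζ
  have e2 := eq_add_mul_dslope_zero u 1
  linear_combination e1 + ζ * (k1 - k2) - ζ * e2

open Metric in
/-- A holomorphic function is determined by the real part of its boundary values and its value
at `1`. -/
theorem DiffContOnCl.eq_of_re_eq {f g : ℂ → ℂ}
    (hf : DiffContOnCl ℂ f (ball 0 1)) (hg : DiffContOnCl ℂ g (ball 0 1))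
    (h : ∀ ζ : ℂ, ‖ζ‖ = 1 → (f ζ).re = (g ζ).re) (h1 : f 1 = g 1) {ζ : ℂ}
    (hζ : ζ ∈ closedBall (0 : ℂ) 1) : f ζ = g ζ := by
  have hd := (hf.sub hg).const_smul Complex.I
  have key := fun z hz => hd.eq_zero_value_of_im_eq_zero (fun z hz => by simp [h z hz]) (ζ := z) hz
  have k := (key ζ hζ).trans (key 1 (by simp)).symm
  simp only [Pi.smul_apply, Pi.sub_apply, smul_eq_mul, h1, sub_self] at k
  have k' := mul_left_cancel₀ Complex.I_ne_zero k
  linear_combination k'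

noncomputable section

section SmallSolutions

open scoped Matrix.Norms.L2Operator

variable {n d : ℕ}

/-! ### Stein equations `Z - ᵗX̄ Z X = E` -/

/-- The map `Z ↦ X* Z Y` strictly decreases nonzero norms. With `X = Y` this gives injectivity of
the Stein operator; with two different small solutions it gives their equality. -/
theorem eq_zero_of_eq_mul_mul {X Y Z : Matrix (Fin n) (Fin n) ℂ} (hX : ‖X‖ < 1) (hY : ‖Y‖ < 1)
    (h : Z = Xᴴ * Z * Y) : Z = 0 := by
  by_contra hZ
  have hpos : 0 < ‖Z‖ := norm_pos_iff.2 hZ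
  have h1 : ‖Z‖ ≤ ‖X‖ * ‖Z‖ * ‖Y‖ := by
    calc ‖Z‖ = ‖Xᴴ * Z * Y‖ := congrArg _ h
      _ ≤ ‖Xᴴ * Z‖ * ‖Y‖ := norm_mul_le _ _
      _ ≤ ‖Xᴴ‖ * ‖Z‖ * ‖Y‖ := by gcongr; exact norm_mul_le _ _
      _ = _ := by rw [Matrix.l2_opNorm_conjTranspose]
  have h2 : ‖X‖ * ‖Z‖ * ‖Y‖ ≤ ‖X‖ * ‖Z‖ := mul_le_of_le_one_right (by positivity) hY.le
  nlinarith

/-- The linear map `Z ↦ Z - ᵗX̄ Z X`. -/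
def stein (X : Matrix (Fin n) (Fin n) ℂ) :
    Matrix (Fin n) (Fin n) ℂ →ₗ[ℂ] Matrix (Fin n) (Fin n) ℂ where
  toFun Z := Z - Xᴴ * Z * X
  map_add' Y Z := by simp only [mul_add, add_mul]; abel
  map_smul' c Z := by simp [smul_sub]

theorem stein_apply (X Z : Matrix (Fin n) (Fin n) ℂ) : stein X Z = Z - Xᴴ * Z * X := rfl

theorem stein_injective {X : Matrix (Fin n) (Fin n) ℂ} (hX : ‖X‖ < 1) :
    Function.Injective (stein X) := by
  rw [injective_iff_map_eq_zero]
  intro Z hZ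
  rw [stein_apply, sub_eq_zero] at hZ
  exact eq_zero_of_eq_mul_mul hX hX hZ

theorem stein_surjective {X : Matrix (Fin n) (Fin n) ℂ} (hX : ‖X‖ < 1) :
    Function.Surjective (stein X) :=
  LinearMap.injective_iff_surjective.1 (stein_injective hX)

theorem stein_conjTranspose (X Z : Matrix (Fin n) (Fin n) ℂ) : stein X Zᴴ = (stein X Z)ᴴ := by
  simp [stein_apply, Matrix.mul_assoc]

theorem isHermitian_of_stein {X K B : Matrix (Fin n) (Fin n) ℂ} (hX : ‖X‖ < 1)
    (hB : B.IsHermitian) (hK : stein X K = B) : K.IsHermitian := by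
  apply stein_injective hX
  rw [stein_conjTranspose, hK, hB.eq]

theorem isUnit_one_sub_smul {X : Matrix (Fin n) (Fin n) ℂ} (hX : ‖X‖ < 1) {ζ : ℂ}
    (hζ : ‖ζ‖ ≤ 1) : IsUnit (1 - ζ • X) := by
  apply isUnit_one_sub_of_norm_lt_one
  rw [norm_smul]
  exact (mul_le_of_le_one_left (norm_nonneg _) hζ).trans_lt hX

theorem isUnit_one_sub {X : Matrix (Fin n) (Fin n) ℂ} (hX : ‖X‖ < 1) : IsUnit (1 - X) :=
  isUnit_one_sub_of_norm_lt_one hX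

/-! ### Solutions of `P X² + A X + ᵗP̄ = 0` -/

theorem coeffP_conjTranspose {A : Fin d → Matrix (Fin n) (Fin n) ℂ}
    (hA : ∀ j, (A j).IsHermitian) (a : Fin d → ℂ) :
    (coeffP A a)ᴴ = ∑ j, star (a j) • A j := by
  simp [coeffP, Matrix.conjTranspose_sum, (hA _).eq]

theorem coeffA_isHermitian {A : Fin d → Matrix (Fin n) (Fin n) ℂ}
    (hA : ∀ j, (A j).IsHermitian) (b : Fin d → ℝ) (a : Fin d → ℂ) :
    (coeffA A b a).IsHermitian := by
  rw [Matrix.IsHermitian, coeffA, Matrix.conjTranspose_sum]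
  refine Finset.sum_congr rfl fun j _ => ?_
  rw [Matrix.conjTranspose_smul, (hA j).eq]
  congr 1
  simp
  ring

/-- The matrix `A + P X`. -/
def middle (A : Fin d → Matrix (Fin n) (Fin n) ℂ) (b : Fin d → ℝ)
    (a : Fin d → ℂ) (X : Matrix (Fin n) (Fin n) ℂ) : Matrix (Fin n) (Fin n) ℂ :=
  coeffA A b a + coeffP A a * X

/-- `X` is a solution of the matrix equation with `‖X‖ < 1` for which `A + P X` is invertible. -/
structure IsRegularSolution (A : Fin d → Matrix (Fin n) (Fin n) ℂ) (b : Fin d → ℝ)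
    (a : Fin d → ℂ) (X : Matrix (Fin n) (Fin n) ℂ) : Prop where
  eq : coeffP A a * X ^ 2 + coeffA A b a * X + (coeffP A a)ᴴ = 0
  norm_lt : ‖X‖ < 1
  isUnit : IsUnit (middle A b a X)

variable {A : Fin d → Matrix (Fin n) (Fin n) ℂ} {b : Fin d → ℝ} {a : Fin d → ℂ}
  {X : Matrix (Fin n) (Fin n) ℂ}

theorem coeffP_conjTranspose_eq_neg
    (h : coeffP A a * X ^ 2 + coeffA A b a * X + (coeffP A a)ᴴ = 0) :
    (coeffP A a)ᴴ = -(middle A b a X * X) := by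
  rw [eq_neg_iff_add_eq_zero, ← h, middle, pow_two]
  noncomm_ring

/-- Inserting `P* = -QX` and its adjoint into `Q = A + PX` gives `Q = A - X* Q* X` and `Q* = A - X*
Q X`. The difference `Q - Q*` is therefore killed by the Stein operator. -/
theorem middle_isHermitian (hA : ∀ j, (A j).IsHermitian)
    (h : coeffP A a * X ^ 2 + coeffA A b a * X + (coeffP A a)ᴴ = 0) (hX : ‖X‖ < 1) :
    (middle A b a X).IsHermitian := by
  have h1 := coeffP_conjTranspose_eq_neg h
  have h2 : coeffP A a = -(Xᴴ * (middle A b a X)ᴴ) := by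
    rw [← Matrix.conjTranspose_conjTranspose (coeffP A a), h1]; simp
  have h3 : (middle A b a X)ᴴ = coeffA A b a - Xᴴ * middle A b a X * X := by
    conv_lhs => rw [middle]
    rw [Matrix.conjTranspose_add, Matrix.conjTranspose_mul, h1, (coeffA_isHermitian hA b a).eq]
    noncomm_ring
  have h4 : middle A b a X = coeffA A b a - Xᴴ * (middle A b a X)ᴴ * X := by
    conv_lhs => rw [middle, h2]
    noncomm_ring
  have : middle A b a X - (middle A b a X)ᴴ = 0 := by
    have : stein X (middle A b a X - (middle A b a X)ᴴ) = 0 := by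
      rw [stein_apply]
      calc _ = (middle A b a X + Xᴴ * (middle A b a X)ᴴ * X) -
              ((middle A b a X)ᴴ + Xᴴ * (middle A b a X) * X) := by noncomm_ring
        _ = coeffA A b a - coeffA A b a := by
            rw [eq_sub_iff_add_eq.1 h3, eq_sub_iff_add_eq.1 h4]
        _ = 0 := sub_self _
    exact stein_injective hX (by rw [this, map_zero])
  exact (sub_eq_zero.1 this).symm

theorem coeffP_eq_neg (hA : ∀ j, (A j).IsHermitian)
    (h : coeffP A a * X ^ 2 + coeffA A b a * X + (coeffP A a)ᴴ = 0) (hX : ‖X‖ < 1) :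
    coeffP A a = -(Xᴴ * middle A b a X) := by
  rw [← Matrix.conjTranspose_conjTranspose (coeffP A a), coeffP_conjTranspose_eq_neg h]
  simp [(middle_isHermitian hA h hX).eq]

namespace IsRegularSolution

/-- Subtracting the equations for `Y` and `X` gives `Q(Y - X) = -P(Y - X)Y`. Since `P = -X* Q`, the
matrix `Q(Y - X)` is a fixed point of the contraction `Z ↦ X* Z Y`. -/
theorem isSmallSolution (hA : ∀ j, (A j).IsHermitian) (h : IsRegularSolution A b a X) :
    IsSmallSolution A b a X := by
  refine ⟨⟨h.eq, h.norm_lt⟩, fun Y hY hY1 => ?_⟩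
  have hP := coeffP_eq_neg hA h.eq h.norm_lt
  have h1 : middle A b a X * (Y - X) = -(coeffP A a * (Y - X) * Y) := by
    rw [eq_neg_iff_add_eq_zero]
    calc _ = (coeffP A a * Y ^ 2 + coeffA A b a * Y + (coeffP A a)ᴴ) -
          (coeffP A a * X ^ 2 + coeffA A b a * X + (coeffP A a)ᴴ) := by
          rw [middle]; noncomm_ring
      _ = 0 := by rw [hY, h.eq, sub_zero]
  have h2 : middle A b a X * (Y - X) = Xᴴ * (middle A b a X * (Y - X)) * Y := by
    calc _ = -(coeffP A a * (Y - X) * Y) := h1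
      _ = _ := by rw [hP]; noncomm_ring
  have h3 := eq_zero_of_eq_mul_mul h.norm_lt hY1 h2
  exact sub_eq_zero.1 (h.isUnit.mul_right_eq_zero.1 h3)

end IsRegularSolution

/-- The matrix `∑ c_j(ζ) A_j` for a point `ζ` of the unit circle. -/
theorem symbol_factorization (hA : ∀ j, (A j).IsHermitian)
    (h : coeffP A a * X ^ 2 + coeffA A b a * X + (coeffP A a)ᴴ = 0) (hX : ‖X‖ < 1) {ζ : ℂ}
    (hζ : ‖ζ‖ = 1) :
    ∑ j, (a j * star ζ + (b j - a j - star (a j)) + star (a j) * ζ) • A j =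
      (1 - ζ • X)ᴴ * middle A b a X * (1 - ζ • X) := by
  have h1 : ∑ j, (a j * star ζ + (b j - a j - star (a j)) + star (a j) * ζ) • A j =
      star ζ • coeffP A a + coeffA A b a + ζ • (coeffP A a)ᴴ := by
    rw [coeffP_conjTranspose hA, coeffP, coeffA, Finset.smul_sum, Finset.smul_sum,
      ← Finset.sum_add_distrib, ← Finset.sum_add_distrib]
    refine Finset.sum_congr rfl fun j _ => ?_
    simp only [add_smul, smul_smul, mul_comm]
  have h2 : coeffA A b a = middle A b a X - coeffP A a * X := by rw [middle]; abel
  have hz : ζ * star ζ = 1 := mul_star_eq_one_of_norm_eq_one hζ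
  -- All coefficients are now expressed by `Q` and `X`: `P = -X* Q`, `P* = -QX`, `A = Q + X* Q X`.
  -- The term `ζ̄ζ X* Q X` of the product loses its `ζ` because `|ζ| = 1`.
  rw [h1, coeffP_conjTranspose_eq_neg h, h2, coeffP_eq_neg hA h hX]
  simp only [Matrix.conjTranspose_sub, Matrix.conjTranspose_one, Matrix.conjTranspose_smul,
    sub_mul, mul_sub, one_mul, mul_one, smul_mul_assoc, mul_smul_comm, smul_sub, smul_smul, smul_neg,
    neg_mul, hz, one_smul]
  abel

/-- This is the factorization at `ζ = 1`. It makes `∑ b_j A_j` invertible when `Q` is, and it puts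
`h̃'(1)` in the form required by `jetInclusion`. -/
theorem pencil_eq (hA : ∀ j, (A j).IsHermitian)
    (h : coeffP A a * X ^ 2 + coeffA A b a * X + (coeffP A a)ᴴ = 0) (hX : ‖X‖ < 1) :
    pencil A b = (1 - X)ᴴ * middle A b a X * (1 - X) := by
  have := symbol_factorization hA h hX (ζ := 1) (by simp)
  rw [one_smul] at this
  rw [← this, pencil]
  refine Finset.sum_congr rfl fun j _ => ?_
  congr 1
  simp
  ring

end SmallSolutions

end

noncomputable section

section Lifts

open scoped Matrix.Norms.L2Operator

variable {n d : ℕ}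

/-! ### Differentiability of matrix-valued maps -/

/-- The entry `(i, j)` of a matrix, as a continuous linear map. -/
def entryCLM (i j : Fin n) : Matrix (Fin n) (Fin n) ℂ →L[ℂ] ℂ :=
  ⟨Matrix.entryLinearMap ℂ ℂ i j, by exact continuous_id.matrix_elem i j⟩

theorem differentiableAt_mulVec {M : ℂ → Matrix (Fin n) (Fin n) ℂ} {ζ : ℂ}
    (hM : DifferentiableAt ℂ M ζ) {v : ℂ → Fin n → ℂ} (hv : DifferentiableAt ℂ v ζ) :
    DifferentiableAt ℂ (fun z => M z *ᵥ v z) ζ := by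
  refine differentiableAt_pi.2 fun i => ?_
  change DifferentiableAt ℂ (fun z => ∑ j, M z i j * v z j) ζ
  refine DifferentiableAt.fun_sum fun j _ => ?_
  have hv' : DifferentiableAt ℂ (fun z => v z j) ζ := differentiableAt_pi.1 hv j
  exact ((entryCLM i j).differentiableAt.comp ζ hM).mul hv'

theorem differentiableAt_vecMul {M : ℂ → Matrix (Fin n) (Fin n) ℂ} {ζ : ℂ}
    (hM : DifferentiableAt ℂ M ζ) {v : ℂ → Fin n → ℂ} (hv : DifferentiableAt ℂ v ζ) :
    DifferentiableAt ℂ (fun z => v z ᵥ* M z) ζ := by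
  refine differentiableAt_pi.2 fun i => ?_
  change DifferentiableAt ℂ (fun z => ∑ j, v z j * M z j i) ζ
  refine DifferentiableAt.fun_sum fun j _ => ?_
  have hv' : DifferentiableAt ℂ (fun z => v z j) ζ := differentiableAt_pi.1 hv j
  exact hv'.mul ((entryCLM j i).differentiableAt.comp ζ hM)

theorem differentiableAt_dotProduct {v : ℂ → Fin n → ℂ} {ζ : ℂ} (w : Fin n → ℂ)
    (hv : DifferentiableAt ℂ v ζ) : DifferentiableAt ℂ (fun z => w ⬝ᵥ v z) ζ := by
  refine DifferentiableAt.fun_sum fun j _ => ?_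
  exact (differentiableAt_pi.1 hv j).const_mul _

theorem differentiableAt_one_sub_smul (X : Matrix (Fin n) (Fin n) ℂ) (ζ : ℂ) :
    DifferentiableAt ℂ (fun z : ℂ => 1 - z • X) ζ :=
  (differentiableAt_id.smul_const X).const_sub 1

theorem differentiableAt_resolvent {X : Matrix (Fin n) (Fin n) ℂ} (hX : ‖X‖ < 1) {ζ : ℂ}
    (hζ : ‖ζ‖ ≤ 1) : DifferentiableAt ℂ (fun z : ℂ => (1 - z • X)⁻¹) ζ := by
  simp_rw [Matrix.nonsing_inv_eq_ringInverse]
  obtain ⟨u, hu⟩ := isUnit_one_sub_smul hX hζ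
  have h1 : DifferentiableAt ℂ Ring.inverse (1 - ζ • X) := by
    rw [← hu]; exact differentiableAt_inverse u.isUnit
  exact h1.comp ζ (differentiableAt_one_sub_smul X ζ)

/-! ### The lift with given parameters -/

/-- The components `(h, g, h̃, g̃)` of the lift with parameters `(a, V)`, written with the solution
`X` of the matrix equation and the solutions `K_j` of the Stein equations
`K_j - ᵗX̄ K_j X = A_j`. -/
def liftFun (A : Fin d → Matrix (Fin n) (Fin n) ℂ) (b : Fin d → ℝ) (a : Fin d → ℂ)
    (X : Matrix (Fin n) (Fin n) ℂ) (K : Fin d → Matrix (Fin n) (Fin n) ℂ) (V : Fin n → ℂ)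
    (ζ : ℂ) : CRSpace n d × CRSpace n d :=
  (((1 - ζ) • ((1 - ζ • X)⁻¹ *ᵥ ((1 - X) *ᵥ V)),
    fun j => (1 - ζ) • (2 * (star ((1 - X) *ᵥ V) ⬝ᵥ
      (K j * (1 - X)) *ᵥ ((1 - ζ • X)⁻¹ *ᵥ ((1 - X) *ᵥ V))))),
   ((1 - ζ) • (star ((1 - X) *ᵥ V) ᵥ* (middle A b a X * (1 - ζ • X))),
    fun j => (a j + ((b j : ℂ) - a j - star (a j)) * ζ + star (a j) * ζ ^ 2) / 2))

variable {A : Fin d → Matrix (Fin n) (Fin n) ℂ} {b : Fin d → ℝ} {a : Fin d → ℂ}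
  {X : Matrix (Fin n) (Fin n) ℂ} {K : Fin d → Matrix (Fin n) (Fin n) ℂ} {V : Fin n → ℂ}

theorem liftFun_differentiableAt (hX : ‖X‖ < 1) {ζ : ℂ} (hζ : ‖ζ‖ ≤ 1) :
    DifferentiableAt ℂ (liftFun A b a X K V) ζ := by
  have h1 : DifferentiableAt ℂ (fun z : ℂ => 1 - z) ζ := differentiableAt_id.const_sub 1
  have hR := differentiableAt_mulVec (differentiableAt_resolvent hX hζ)
    (differentiableAt_const ((1 - X) *ᵥ V))
  refine ((h1.smul hR).prodMk (differentiableAt_pi.2 fun j => h1.smul ?_)).prodMk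
    ((h1.smul ?_).prodMk (differentiableAt_pi.2 fun j => ?_))
  · exact (differentiableAt_dotProduct _
      (differentiableAt_mulVec (differentiableAt_const _) hR)).const_mul 2
  · exact differentiableAt_vecMul ((differentiableAt_one_sub_smul X ζ).const_mul _)
      (differentiableAt_const _)
  · fun_prop

/-- The components `h`, `g`, `h̃` of a lift carry the factor `1 - ζ`, so their derivatives at `1`
need only the value of the other factor. -/
theorem hasDerivAt_one_sub_smul {E : Type*} [NormedAddCommGroup E] [NormedSpace ℂ E] {f : ℂ → E}
    (hf : DifferentiableAt ℂ f 1) : HasDerivAt (fun z => (1 - z) • f z) (-(f 1)) 1 := by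
  have h1 : HasDerivAt (fun z : ℂ => 1 - z) (-1) 1 := (hasDerivAt_id (1 : ℂ)).const_sub 1
  exact (h1.smul hf.hasDerivAt).congr_deriv (by simp)

theorem liftFun_hasDerivAt_one (hX : ‖X‖ < 1) :
    HasDerivAt (liftFun A b a X K V)
      ((-V, fun j => -(2 * (star ((1 - X) *ᵥ V) ⬝ᵥ K j *ᵥ ((1 - X) *ᵥ V)))),
       (-(star ((1 - X) *ᵥ V) ᵥ* (middle A b a X * (1 - X))),
        fun j => ((b j : ℂ) - a j + star (a j)) / 2)) 1 := by
  have hR := differentiableAt_mulVec (differentiableAt_resolvent hX (ζ := 1) (by simp))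
    (differentiableAt_const ((1 - X) *ᵥ V))
  have hu : IsUnit (1 - X).det := (Matrix.isUnit_iff_isUnit_det _).1 (isUnit_one_sub hX)
  refine (HasDerivAt.prodMk ?_ (hasDerivAt_pi.2 fun j => ?_)).prodMk
    (HasDerivAt.prodMk ?_ (hasDerivAt_pi.2 fun j => ?_))
  · have := hasDerivAt_one_sub_smul hR
    simpa [Matrix.nonsing_inv_mul _ hu] using this
  · have := hasDerivAt_one_sub_smul ((differentiableAt_dotProduct (star ((1 - X) *ᵥ V))
      (differentiableAt_mulVec (differentiableAt_const (K j * (1 - X))) hR)).const_mul 2)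
    refine this.congr_deriv ?_
    rw [one_smul, Matrix.mulVec_mulVec, Matrix.mulVec_mulVec, Matrix.mulVec_mulVec, mul_assoc,
      Matrix.nonsing_inv_mul _ hu, mul_one]
  · have := hasDerivAt_one_sub_smul (differentiableAt_vecMul
      ((differentiableAt_one_sub_smul X 1).const_mul (middle A b a X))
      (differentiableAt_const (star ((1 - X) *ᵥ V))))
    simpa using this
  · have h1 := (((hasDerivAt_id (1 : ℂ)).const_mul ((b j : ℂ) - a j - star (a j))).const_add
      (a j)).add (((hasDerivAt_id (1 : ℂ)).pow 2).const_mul (star (a j)))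
    refine (h1.div_const 2).congr_deriv ?_
    simp
    ring

theorem liftFun_apply_one :
    liftFun A b a X K V 1 = ((0, 0), (0, fun j => (b j : ℂ) / 2)) := by
  refine Prod.ext (Prod.ext (by simp [liftFun]) (by ext j; simp [liftFun]))
    (Prod.ext (by simp [liftFun]) (by ext j; simp [liftFun]; ring))

theorem liftFun_apply_zero : (liftFun A b a X K V 0).1.1 = (1 - X) *ᵥ V ∧
    (liftFun A b a X K V 0).2.2 = fun j => a j / 2 := by
  constructor
  · simp [liftFun]
  · ext j; simp [liftFun]

theorem star_dotProduct_mulVec (v w : Fin n → ℂ) (M : Matrix (Fin n) (Fin n) ℂ) :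
    star (star v ⬝ᵥ M *ᵥ w) = star w ⬝ᵥ Mᴴ *ᵥ v := by
  rw [Matrix.star_dotProduct, star_star, Matrix.star_mulVec, Matrix.dotProduct_mulVec,
    dotProduct_comm]

/-- `Re g_j = ᵗh̄ A_j h` on the unit circle. -/
theorem liftFun_fst_mem_quadric (hA : ∀ j, (A j).IsHermitian) (hX : ‖X‖ < 1)
    (hK : ∀ j, stein X (K j) = A j) {ζ : ℂ} (hζ : ‖ζ‖ = 1) :
    (liftFun A b a X K V ζ).1 ∈ quadric A := by
  intro j
  have hz := mul_star_eq_one_of_norm_eq_one hζ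
  have hu := (Matrix.isUnit_iff_isUnit_det _).1 (isUnit_one_sub_smul hX hζ.le)
  have hKh := isHermitian_of_stein hX (hA j) (hK j)
  simp only [liftFun]
  set W := (1 - X) *ᵥ V with hW
  set R := (1 - ζ • X)⁻¹ with hR
  have hR1 : R = 1 + ζ • (X * R) := by
    have h := Matrix.mul_nonsing_inv _ hu
    rw [← hR, sub_mul, one_mul, smul_mul_assoc, sub_eq_iff_eq_add] at h
    exact h
  set s := star W ⬝ᵥ (K j * X * R) *ᵥ W with hs
  set κ := star W ⬝ᵥ K j *ᵥ W with hκ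
  have hκr : star κ = κ := by
    rw [hκ, star_dotProduct_mulVec, hKh.eq]
  have hp : star W ⬝ᵥ (K j * R) *ᵥ W = κ + ζ * s := by
    conv_lhs => rw [hR1]
    rw [mul_add, mul_one, mul_smul_comm, Matrix.add_mulVec, Matrix.smul_mulVec, dotProduct_add,
      dotProduct_smul, smul_eq_mul, ← mul_assoc]
  have hs' : star W ⬝ᵥ (Rᴴ * Xᴴ * K j) *ᵥ W = star s := by
    rw [hs, star_dotProduct_mulVec, Matrix.conjTranspose_mul, Matrix.conjTranspose_mul, hKh.eq,
      mul_assoc]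
  -- On the circle the Stein equation reads `A_j = (1 - ζX)* K_j + ζ̄ X* K_j (1 - ζX)`. Each summand
  -- contains one factor that cancels against the resolvent.
  have hRA : Rᴴ * A j * R = K j * R + star ζ • (Rᴴ * Xᴴ * K j) := by
    have e1 : A j = (1 - ζ • X)ᴴ * K j + star ζ • (Xᴴ * K j * (1 - ζ • X)) := by
      rw [← hK j, stein_apply, Matrix.conjTranspose_sub, Matrix.conjTranspose_one,
        Matrix.conjTranspose_smul, mul_sub, smul_sub, mul_smul_comm, smul_smul,
        mul_comm (star ζ) ζ, hz, one_smul, sub_mul, one_mul, mul_one, smul_mul_assoc]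
      abel
    have e2 : Rᴴ * (1 - ζ • X)ᴴ = 1 := by
      rw [← Matrix.conjTranspose_mul, hR, Matrix.mul_nonsing_inv _ hu, Matrix.conjTranspose_one]
    have e3 : (1 - ζ • X) * R = 1 := Matrix.mul_nonsing_inv _ hu
    rw [e1, mul_add, add_mul, ← mul_assoc Rᴴ, e2, one_mul, mul_smul_comm, smul_mul_assoc,
      mul_assoc Rᴴ, mul_assoc _ _ R, e3, mul_one, mul_assoc]
  have lhs : star W ⬝ᵥ (K j * (1 - X)) *ᵥ (R *ᵥ W) = κ + ζ * s - s := by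
    rw [Matrix.mulVec_mulVec, mul_sub, mul_one, sub_mul, Matrix.sub_mulVec, dotProduct_sub, hp]
  have rhs : star ((1 - ζ) • (R *ᵥ W)) ⬝ᵥ A j *ᵥ ((1 - ζ) • (R *ᵥ W)) =
      (1 - star ζ) * (1 - ζ) * (κ + ζ * s + star ζ * star s) := by
    rw [star_smul, Matrix.mulVec_smul, smul_dotProduct, dotProduct_smul, Matrix.star_mulVec,
      ← Matrix.dotProduct_mulVec, Matrix.mulVec_mulVec, Matrix.mulVec_mulVec, hRA,
      Matrix.add_mulVec, Matrix.smul_mulVec, dotProduct_add, dotProduct_smul, hp, hs']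
    simp only [star_sub, star_one, smul_eq_mul]
    ring
  rw [lhs, rhs]
  have hre : ∀ p q : ℂ, p + star p = q + star q → p.re = q.re := by
    intro p q h
    have := congrArg Complex.re h
    simp at this
    linarith
  apply hre
  simp only [smul_eq_mul, star_mul', star_add, star_sub, star_one, star_star, hκr, star_ofNat]
  linear_combination (2 * s + 2 * star s - 2 * ζ * s - 2 * star ζ * star s - 2 * κ) * hz

/-- The boundary function `c_j` of the lift with parameter `a`. -/
def boundaryCoeff (b : Fin d → ℝ) (a : Fin d → ℂ) (j : Fin d) (ζ : ℂ) : ℝ :=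
  (a j * star ζ + ((b j : ℂ) - a j - star (a j)) + star (a j) * ζ).re

theorem boundaryCoeff_eq (b : Fin d → ℝ) (a : Fin d → ℂ) (j : Fin d) (ζ : ℂ) :
    (boundaryCoeff b a j ζ : ℂ) =
      a j * star ζ + ((b j : ℂ) - a j - star (a j)) + star (a j) * ζ := by
  rw [boundaryCoeff]
  apply Complex.ext
  · simp
  · simp
    ring

theorem sum_smul_delR (hA : ∀ j, (A j).IsHermitian) (c : Fin d → ℝ) (p : CRSpace n d) :
    ∑ j, c j • delR A j p = (-(star p.1 ᵥ* ∑ j, (c j : ℂ) • A j), fun j => (c j : ℂ) / 2) := by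
  simp_rw [fun j => delR_eq A j (hA j) p]
  refine Prod.ext ?_ ?_
  · rw [Prod.fst_sum]
    ext i
    simp [Matrix.vecMul, dotProduct, Matrix.sum_apply, Finset.mul_sum]
    rw [Finset.sum_comm]
    refine Finset.sum_congr rfl fun k _ => Finset.sum_congr rfl fun j _ => by ring
  · rw [Prod.snd_sum]
    ext i
    simp [Finset.sum_apply, Pi.single_apply]
    ring

end Lifts

end

/-! ### Explicit lifts belong to `𝒮₀(M)`, and the converse. -/

noncomputable section

section Classification

open scoped Matrix.Norms.L2Operator
open Metric

variable {n d : ℕ} {A : Fin d → Matrix (Fin n) (Fin n) ℂ} {b : Fin d → ℝ} {a : Fin d → ℂ}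
  {X : Matrix (Fin n) (Fin n) ℂ} {K : Fin d → Matrix (Fin n) (Fin n) ℂ} {V : Fin n → ℂ}

theorem discExtend_apply (F : DiscMap n d) (ζ : closedBall (0 : ℂ) 1) :
    discExtend F ζ = F ζ := by
  rw [discExtend, dif_pos ζ.2]

theorem discExtend_of_mem (F : DiscMap n d) {ζ : ℂ} (h : ζ ∈ closedBall (0 : ℂ) 1) :
    discExtend F ζ = F ⟨ζ, h⟩ := by
  rw [discExtend, dif_pos h]

theorem discExtend_diffContOnCl {F : DiscMap n d}
    (h : DifferentiableOn ℂ (discExtend F) (ball 0 1)) :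
    DiffContOnCl ℂ (discExtend F) (ball 0 1) := by
  refine ⟨h, ?_⟩
  rw [closure_ball _ one_ne_zero, continuousOn_iff_continuous_domRestrict]
  exact F.continuous.congr fun ζ => (discExtend_apply F ζ).symm

/-- The disc map with components `liftFun`. -/
def liftMap (A : Fin d → Matrix (Fin n) (Fin n) ℂ) (b : Fin d → ℝ) (a : Fin d → ℂ)
    (X : Matrix (Fin n) (Fin n) ℂ) (hX : ‖X‖ < 1) (K : Fin d → Matrix (Fin n) (Fin n) ℂ)
    (V : Fin n → ℂ) : DiscMap n d where
  toFun ζ := liftFun A b a X K V ζ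
  continuous_toFun := continuous_iff_continuousAt.2 fun ζ =>
    (liftFun_differentiableAt hX (mem_closedBall_zero_iff.1 ζ.2)).continuousAt.comp
      continuous_subtype_val.continuousAt

theorem discExtend_liftMap (hX : ‖X‖ < 1) {ζ : ℂ} (h : ζ ∈ closedBall (0 : ℂ) 1) :
    discExtend (liftMap A b a X hX K V) ζ = liftFun A b a X K V ζ := by
  rw [discExtend_of_mem _ h]; rfl

theorem liftMap_hasDerivWithinAt_one (hX : ‖X‖ < 1) :
    HasDerivWithinAt (discExtend (liftMap A b a X hX K V))
      ((-V, fun j => -(2 * (star ((1 - X) *ᵥ V) ⬝ᵥ K j *ᵥ ((1 - X) *ᵥ V)))),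
       (-(star ((1 - X) *ᵥ V) ᵥ* (middle A b a X * (1 - X))),
        fun j => ((b j : ℂ) - a j + star (a j)) / 2)) (closedBall 0 1) 1 :=
  (liftFun_hasDerivAt_one hX).hasDerivWithinAt.congr (fun _ hζ => discExtend_liftMap hX hζ)
    (discExtend_liftMap hX (by simp))

theorem sum_boundaryCoeff (hA : ∀ j, (A j).IsHermitian) (h : IsRegularSolution A b a X) {ζ : ℂ}
    (hζ : ‖ζ‖ = 1) : ∑ j, (boundaryCoeff b a j ζ : ℂ) • A j =
      (1 - ζ • X)ᴴ * middle A b a X * (1 - ζ • X) := by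
  simp_rw [boundaryCoeff_eq]
  exact symbol_factorization hA h.eq h.norm_lt hζ

/-- In `-ζ h* ∑ c_j A_j` the left factor `(1 - ζX)*` of the symbol cancels the resolvent inside
`h*`, and `-ζ(1 - ζ̄) = 1 - ζ` on the circle. What remains is polynomial in `ζ`. -/
theorem liftFun_snd (hA : ∀ j, (A j).IsHermitian) (h : IsRegularSolution A b a X) {ζ : ℂ}
    (hζ : ‖ζ‖ = 1) : (liftFun A b a X K V ζ).2 =
      ζ • ∑ j, boundaryCoeff b a j ζ • delR A j (liftFun A b a X K V ζ).1 := by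
  have hz := mul_star_eq_one_of_norm_eq_one hζ
  have hu := (Matrix.isUnit_iff_isUnit_det _).1 (isUnit_one_sub_smul h.norm_lt hζ.le)
  rw [sum_smul_delR hA, sum_boundaryCoeff hA h hζ]
  refine Prod.ext ?_ ?_
  · simp only [liftFun, Prod.smul_fst, star_smul, Matrix.star_mulVec ((1 - ζ • X)⁻¹)]
    rw [Matrix.smul_vecMul, Matrix.vecMul_vecMul, ← mul_assoc, ← mul_assoc,
      ← Matrix.conjTranspose_mul, Matrix.mul_nonsing_inv _ hu, Matrix.conjTranspose_one, one_mul,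
      smul_neg, smul_smul, ← neg_smul]
    congr 1
    simp only [star_sub, star_one]
    linear_combination -hz
  · ext j
    simp only [liftFun, Prod.smul_snd, Pi.smul_apply, boundaryCoeff_eq, smul_eq_mul]
    linear_combination -(a j) / 2 * hz

theorem liftMap_mem_pointedLifts (hA : ∀ j, (A j).IsHermitian) (h : IsRegularSolution A b a X)
    (hK : ∀ j, stein X (K j) = A j) (hV : V ≠ 0) :
    liftMap A b a X h.norm_lt K V ∈ pointedLifts A b := by
  have hX := h.norm_lt
  refine ⟨⟨?_, ?_, ?_, boundaryCoeff b a, ?_⟩, ?_⟩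
  · intro ζ hζ
    refine DifferentiableWithinAt.congr (f := liftFun A b a X K V) ?_
      (fun z hz => discExtend_liftMap hX (ball_subset_closedBall hz))
      (discExtend_liftMap hX (ball_subset_closedBall hζ))
    exact (liftFun_differentiableAt hX (mem_ball_zero_iff.1 hζ).le).differentiableWithinAt
  · rintro ⟨p, hp⟩
    have h0 := hp ⟨0, by simp⟩
    have h1 := hp ⟨1, by simp⟩
    have e : (liftFun A b a X K V 0).1 = (liftFun A b a X K V 1).1 := h0.trans h1.symm
    have e' := congrArg Prod.fst e
    rw [liftFun_apply_zero.1, liftFun_apply_one] at e'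
    refine hV (Matrix.mulVec_injective_of_isUnit (isUnit_one_sub hX) ?_)
    simpa using e'
  · intro ζ hζ
    exact liftFun_fst_mem_quadric hA hX hK hζ
  · intro ζ hζ
    refine ⟨fun h0 => ?_, liftFun_snd hA h hζ⟩
    rw [sum_smul_delR hA] at h0
    have hc : ∀ j, (boundaryCoeff b a j ζ : ℂ) = 0 := fun j => by
      have := congrFun (congrArg Prod.snd h0) j
      simpa using this
    have h1 := sum_boundaryCoeff hA h hζ
    simp only [hc, zero_smul, Finset.sum_const_zero] at h1
    have hu := isUnit_one_sub_smul hX hζ.le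
    -- If all `c_j(ζ)` vanished, the invertible symbol would be zero. This is absurd unless `n = 0`,
    -- which `V ≠ 0` excludes.
    have h2 : IsUnit (0 : Matrix (Fin n) (Fin n) ℂ) := by
      rw [h1]
      exact (hu.star.mul h.isUnit).mul hu
    have h3 := Matrix.mulVec_injective_of_isUnit h2 (a₁ := V) (a₂ := 0) (by simp)
    exact hV h3
  · rw [discExtend_liftMap hX (by simp), liftFun_apply_one]

/-! ### Every nearby lift has parameters -/

theorem coeff_eq_of_mem_circle (hA : ∀ j, (A j).IsHermitian) {F : CRSpace n d × CRSpace n d}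
    {ζ : ℂ} (hζ : ‖ζ‖ = 1) {c : Fin d → ℝ} (h : F.2 = ζ • ∑ j, c j • delR A j F.1) (j : Fin d) :
    (c j : ℂ) = 2 * star ζ * F.2.2 j := by
  have hz := mul_star_eq_one_of_norm_eq_one hζ
  rw [sum_smul_delR hA] at h
  have := congrFun (congrArg Prod.snd h) j
  simp only [Prod.smul_snd, Pi.smul_apply, smul_eq_mul] at this
  rw [this]
  linear_combination -(c j : ℂ) * hz

/-- A pointed lift is determined by its components `h` and `g̃`. -/
theorem pointedLifts_ext (hA : ∀ j, (A j).IsHermitian) {F G : DiscMap n d}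
    (hF : F ∈ pointedLifts A b) (hG : G ∈ pointedLifts A b)
    (h1 : ∀ ζ, (F ζ).1.1 = (G ζ).1.1) (h2 : ∀ ζ, (F ζ).2.2 = (G ζ).2.2) : F = G := by
  obtain ⟨⟨hFd, -, hFq, cF, hcF⟩, hF1⟩ := hF
  obtain ⟨⟨hGd, -, hGq, cG, hcG⟩, hG1⟩ := hG
  have dF := discExtend_diffContOnCl hFd
  have dG := discExtend_diffContOnCl hGd
  have hfr : frontier (ball (0 : ℂ) 1) = sphere 0 1 := frontier_ball _ one_ne_zero
  have hcl : closure (ball (0 : ℂ) 1) = closedBall 0 1 := closure_ball _ one_ne_zero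
  have hcirc : ∀ z : ℂ, ‖z‖ = 1 → z ∈ closedBall (0 : ℂ) 1 := fun z hz => by simp [hz]
  have hsnd : ∀ ζ, (F ζ).2.1 = (G ζ).2.1 := by
    intro ζ
    have d1 : DiffContOnCl ℂ (fun z => (discExtend F z).2.1) (ball 0 1) :=
      (differentiable_fst.comp differentiable_snd).comp_diffContOnCl dF
    have d2 : DiffContOnCl ℂ (fun z => (discExtend G z).2.1) (ball 0 1) :=
      (differentiable_fst.comp differentiable_snd).comp_diffContOnCl dG
    -- On the circle `g̃` determines the `c_j`, and these together with `h` determine `h̃`; the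
    -- maximum principle extends the equality inside.
    have := Complex.eqOn_closure_of_eqOn_frontier isBounded_ball d1 d2 (fun z hz => by
      rw [hfr, mem_sphere_zero_iff_norm] at hz
      have hz' := hcirc z hz
      simp only [discExtend_of_mem _ hz']
      have eF := (hcF ⟨z, hz'⟩ hz).2
      have eG := (hcG ⟨z, hz'⟩ hz).2
      have hc : ∀ j, (cF j z : ℂ) = cG j z := fun j => by
        rw [coeff_eq_of_mem_circle hA hz eF, coeff_eq_of_mem_circle hA hz eG, h2]
      rw [eF, eG, sum_smul_delR hA, sum_smul_delR hA, h1]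
      simp only [hc, Prod.smul_fst])
    have := this (x := ζ) (by rw [hcl]; exact ζ.2)
    simpa only [discExtend_apply] using this
  have hfst : ∀ ζ, (F ζ).1.2 = (G ζ).1.2 := by
    intro ζ
    ext j
    have hd : Differentiable ℂ fun p : CRSpace n d × CRSpace n d => p.1.2 j := by fun_prop
    have d1 : DiffContOnCl ℂ (fun z => (discExtend F z).1.2 j) (ball 0 1) :=
      hd.comp_diffContOnCl dF
    have d2 : DiffContOnCl ℂ (fun z => (discExtend G z).1.2 j) (ball 0 1) :=
      hd.comp_diffContOnCl dG
    -- The equations of the quadric give `Re g_j` from `h`; the remaining imaginary constant is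
    -- fixed by `g(1) = 0`.
    have := d1.eq_of_re_eq d2 (fun z hz => by
      have hz' := hcirc z hz
      simp only [discExtend_of_mem _ hz']
      rw [hFq ⟨z, hz'⟩ hz j, hGq ⟨z, hz'⟩ hz j, h1]) (by rw [hF1, hG1]) (ζ := ζ) ζ.2
    simpa only [discExtend_apply] using this
  ext1 ζ
  exact Prod.ext (Prod.ext (h1 ζ) (hfst ζ)) (Prod.ext (hsnd ζ) (h2 ζ))

/-- The component `g̃` of a pointed lift is a quadratic polynomial. -/
theorem pointedLifts_snd_snd (hA : ∀ j, (A j).IsHermitian) {F : DiscMap n d}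
    (hF : F ∈ pointedLifts A b) (ha : ∀ j, a j = 2 * (discExtend F 0).2.2 j)
    (ζ : closedBall (0 : ℂ) 1) (j : Fin d) :
    (F ζ).2.2 j = (a j + ((b j : ℂ) - a j - star (a j)) * ζ + star (a j) * (ζ : ℂ) ^ 2) / 2 := by
  obtain ⟨⟨hFd, -, hFq, c, hc⟩, hF1⟩ := hF
  have hd : Differentiable ℂ fun p : CRSpace n d × CRSpace n d => 2 * p.2.2 j := by fun_prop
  have d1 : DiffContOnCl ℂ (fun z => 2 * (discExtend F z).2.2 j) (ball 0 1) :=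
    hd.comp_diffContOnCl (discExtend_diffContOnCl hFd)
  have := d1.eq_quadratic_of_eq_mul_real (c := c j) (fun z hz => by
    have hz' : z ∈ closedBall (0 : ℂ) 1 := by simp [hz]
    simp only [discExtend_of_mem _ hz']
    rw [coeff_eq_of_mem_circle hA hz (hc ⟨z, hz'⟩ hz).2 j]
    have := mul_star_eq_one_of_norm_eq_one hz
    linear_combination -2 * (F ⟨z, hz'⟩).2.2 j * this) ζ.2
  simp only [← ha, discExtend_apply, hF1] at this
  linear_combination this / 2

theorem diffContOnCl_mulVec {M : ℂ → Matrix (Fin n) (Fin n) ℂ}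
    (hM : ∀ z : ℂ, ‖z‖ ≤ 1 → DifferentiableAt ℂ M z) {w : ℂ → Fin n → ℂ}
    (hw : DiffContOnCl ℂ w (ball 0 1)) : DiffContOnCl ℂ (fun z => M z *ᵥ w z) (ball 0 1) := by
  refine ⟨fun z hz => (differentiableAt_mulVec (hM z (mem_ball_zero_iff.1 hz).le)
    (hw.differentiableAt isOpen_ball hz)).differentiableWithinAt, continuousOn_pi.2 fun i => ?_⟩
  change ContinuousOn (fun z => ∑ j, M z i j * w z j) _
  refine continuousOn_finsetSum _ fun j _ => ContinuousOn.fun_mul (fun z hz => ?_)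
    (continuousOn_pi.1 hw.continuousOn j)
  rw [closure_ball _ one_ne_zero, mem_closedBall_zero_iff] at hz
  exact ((entryCLM i j).continuous.continuousAt.comp (hM z hz).continuousAt).continuousWithinAt

theorem diffContOnCl_vecMul {M : ℂ → Matrix (Fin n) (Fin n) ℂ}
    (hM : ∀ z : ℂ, ‖z‖ ≤ 1 → DifferentiableAt ℂ M z) {w : ℂ → Fin n → ℂ}
    (hw : DiffContOnCl ℂ w (ball 0 1)) : DiffContOnCl ℂ (fun z => w z ᵥ* M z) (ball 0 1) := by
  refine ⟨fun z hz => (differentiableAt_vecMul (hM z (mem_ball_zero_iff.1 hz).le)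
    (hw.differentiableAt isOpen_ball hz)).differentiableWithinAt, continuousOn_pi.2 fun i => ?_⟩
  change ContinuousOn (fun z => ∑ j, w z j * M z j i) _
  refine continuousOn_finsetSum _ fun j _ => ContinuousOn.fun_mul
    (continuousOn_pi.1 hw.continuousOn j) (fun z hz => ?_)
  rw [closure_ball _ one_ne_zero, mem_closedBall_zero_iff] at hz
  exact ((entryCLM j i).continuous.continuousAt.comp (hM z hz).continuousAt).continuousWithinAt

/-- The component `h` of a pointed lift is given by the solution of the matrix equation. -/
theorem pointedLifts_fst_fst (hA : ∀ j, (A j).IsHermitian) {F : DiscMap n d}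
    (hF : F ∈ pointedLifts A b) (ha : ∀ j, a j = 2 * (discExtend F 0).2.2 j)
    (h : IsRegularSolution A b a X) (ζ : closedBall (0 : ℂ) 1) :
    (F ζ).1.1 = (1 - (ζ : ℂ)) • ((1 - (ζ : ℂ) • X)⁻¹ *ᵥ (discExtend F 0).1.1) := by
  have hq := pointedLifts_snd_snd hA hF ha
  obtain ⟨⟨hFd, -, hFq, c, hc⟩, hF1⟩ := hF
  have dF := discExtend_diffContOnCl hFd
  have hX := h.norm_lt
  have hQ := middle_isHermitian hA h.eq hX
  have hcl : closure (ball (0 : ℂ) 1) = closedBall 0 1 := closure_ball _ one_ne_zero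
  set Q := middle A b a X with hQdef
  -- Since `h̃ = -ζ h* (1 - ζX)* Q (1 - ζX)` on the circle, moving the last factor to the other side
  -- gives `l = ζ u*`, that is `u = ζ l̄`, with `u` and `l` holomorphic. Hence `u` is affine.
  let u : ℂ → Fin n → ℂ := fun z => (Q * (1 - z • X)) *ᵥ (discExtend F z).1.1
  let l : ℂ → Fin n → ℂ := fun z => -((discExtend F z).2.1 ᵥ* (1 - z • X)⁻¹)
  have du : DiffContOnCl ℂ u (ball 0 1) :=
    diffContOnCl_mulVec (fun z _ => (differentiableAt_one_sub_smul X z).const_mul Q)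
      ((differentiable_fst.comp differentiable_fst).comp_diffContOnCl dF)
  have dl : DiffContOnCl ℂ l (ball 0 1) :=
    (diffContOnCl_vecMul (fun z hz => differentiableAt_resolvent hX hz)
      ((differentiable_fst.comp differentiable_snd).comp_diffContOnCl dF)).neg
  have hpi : ∀ k, Differentiable ℂ fun p : Fin n → ℂ => p k := fun k => by fun_prop
  have hul : ∀ z : ℂ, ‖z‖ = 1 → ∀ k, u z k = z * star (l z k) := by
    intro z hz k
    have hz' : z ∈ closedBall (0 : ℂ) 1 := by simp [hz]
    have hzz := mul_star_eq_one_of_norm_eq_one hz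
    have hu := (Matrix.isUnit_iff_isUnit_det _).1 (isUnit_one_sub_smul hX hz.le)
    have hcA : ∑ j, (c j z : ℂ) • A j = (1 - z • X)ᴴ * Q * (1 - z • X) := by
      rw [← sum_boundaryCoeff hA h hz]
      refine Finset.sum_congr rfl fun j _ => ?_
      rw [coeff_eq_of_mem_circle hA hz (hc ⟨z, hz'⟩ hz).2 j, hq, boundaryCoeff_eq]
      congr 1
      simp only
      linear_combination ((b j : ℂ) - a j - star (a j) + star (a j) * z) * hzz
    have e1 : (F ⟨z, hz'⟩).2.1 = -(z • (star (F ⟨z, hz'⟩).1.1 ᵥ*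
        ((1 - z • X)ᴴ * Q * (1 - z • X)))) := by
      rw [(hc ⟨z, hz'⟩ hz).2, sum_smul_delR hA, hcA, Prod.smul_fst, smul_neg]
    have e2 : l z = z • star (u z) := by
      simp only [l, u, discExtend_of_mem _ hz']
      rw [e1, Matrix.neg_vecMul, neg_neg, Matrix.smul_vecMul, Matrix.vecMul_vecMul, mul_assoc,
        Matrix.mul_nonsing_inv _ hu, mul_one, Matrix.star_mulVec, Matrix.conjTranspose_mul, hQ.eq]
    rw [e2]
    simp only [Pi.smul_apply, Pi.star_apply, smul_eq_mul, star_mul', star_star]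
    linear_combination -(u z k) * hzz
  have key : u ζ = (1 - (ζ : ℂ)) • (Q *ᵥ (discExtend F 0).1.1) := by
    ext k
    have := DiffContOnCl.eq_affine_of_eq_mul_star ((hpi k).comp_diffContOnCl du)
      ((hpi k).comp_diffContOnCl dl) (fun z hz => hul z hz k) ζ.2
    -- The normalization `h(1) = 0` turns the affine `u` into `(1 - ζ) u(0)`.
    have u1 : u 1 = 0 := by simp [u, hF1]
    have u0 : u 0 = Q *ᵥ (discExtend F 0).1.1 := by simp [u]
    simp only [Function.comp, u1, u0] at this
    rw [this]
    simp
    ring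
  have hu := (Matrix.isUnit_iff_isUnit_det _).1
    (isUnit_one_sub_smul hX (mem_closedBall_zero_iff.1 ζ.2))
  simp only [u, discExtend_apply] at key
  rw [← Matrix.mulVec_mulVec, ← Matrix.mulVec_smul] at key
  have key2 := Matrix.mulVec_injective_of_isUnit h.isUnit key
  rw [← Matrix.mulVec_smul, ← key2, Matrix.mulVec_mulVec, Matrix.nonsing_inv_mul _ hu,
    Matrix.one_mulVec]

theorem eq_liftMap_of_mem_pointedLifts (hA : ∀ j, (A j).IsHermitian) {F : DiscMap n d}
    (hF : F ∈ pointedLifts A b) (ha : ∀ j, a j = 2 * (discExtend F 0).2.2 j)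
    (h : IsRegularSolution A b a X) (hK : ∀ j, stein X (K j) = A j) (hV0 : V ≠ 0)
    (hV : (1 - X) *ᵥ V = (discExtend F 0).1.1) : liftMap A b a X h.norm_lt K V = F := by
  refine pointedLifts_ext hA (liftMap_mem_pointedLifts hA h hK hV0) hF (fun ζ => ?_) fun ζ => ?_
  · rw [pointedLifts_fst_fst hA hF ha h, ← hV]; rfl
  · ext j
    rw [pointedLifts_snd_snd hA hF ha]; rfl

end Classification

end

/-! ### The parameters `(a, V)` as a chart of `𝒮₀(M)`. -/

noncomputable section

section Chart

open scoped Matrix.Norms.L2Operator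
open Metric

variable {n d : ℕ} {A : Fin d → Matrix (Fin n) (Fin n) ℂ} {b : Fin d → ℝ}

theorem continuous_matrix_inv {T : Type*} [TopologicalSpace T] {M : T → Matrix (Fin n) (Fin n) ℂ}
    (hM : Continuous M) (hu : ∀ t, IsUnit (M t)) : Continuous fun t => (M t)⁻¹ := by
  simp_rw [Matrix.nonsing_inv_eq_ringInverse]
  refine continuous_iff_continuousAt.2 fun t => ?_
  obtain ⟨u, hu⟩ := hu t
  have := NormedRing.inverse_continuousAt u
  rw [hu] at this
  exact this.comp hM.continuousAt

/-- A continuous family of solutions of the matrix equation and of the Stein equations over an open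
set of parameters `a`. -/
structure SolutionFamily (A : Fin d → Matrix (Fin n) (Fin n) ℂ) (b : Fin d → ℝ) where
  base : Set (Fin d → ℂ)
  isOpen_base : IsOpen base
  X : (Fin d → ℂ) → Matrix (Fin n) (Fin n) ℂ
  K : (Fin d → ℂ) → Fin d → Matrix (Fin n) (Fin n) ℂ
  continuousOn_X : ContinuousOn X base
  continuousOn_K : ContinuousOn K base
  isRegular : ∀ a ∈ base, IsRegularSolution A b a (X a)
  stein_eq : ∀ a ∈ base, ∀ j, stein (X a) (K a j) = A j

namespace SolutionFamily

variable (S : SolutionFamily A b)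

/-- The open set of parameters `(a, V)` with `a` in the base and `V ≠ 0`. -/
def source : Set ((Fin d → ℂ) × (Fin n → ℂ)) := S.base ×ˢ {0}ᶜ

theorem isOpen_source : IsOpen S.source := S.isOpen_base.prod isOpen_compl_singleton

/-- The lifts with parameters in `S.source`. -/
def lift (q : S.source) : DiscMap n d :=
  liftMap A b q.1.1 (S.X q.1.1) (S.isRegular _ q.2.1).norm_lt (S.K q.1.1) q.1.2

/-- The lift is jointly continuous in the parameters and `ζ` on the closed disc. Currying then gives
continuity into the space of disc maps. -/
theorem continuous_lift : Continuous S.lift := by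
  have hfst : Continuous fun p : S.source × closedBall (0 : ℂ) 1 => p.1.1.1 := by fun_prop
  have hmem : ∀ p : S.source × closedBall (0 : ℂ) 1, p.1.1.1 ∈ S.base := fun p => p.1.2.1
  have cX : Continuous fun p : S.source × closedBall (0 : ℂ) 1 => S.X p.1.1.1 :=
    S.continuousOn_X.comp_continuous hfst hmem
  have cK : Continuous fun p : S.source × closedBall (0 : ℂ) 1 => S.K p.1.1.1 :=
    S.continuousOn_K.comp_continuous hfst hmem
  have cζ : Continuous fun p : S.source × closedBall (0 : ℂ) 1 => (p.2 : ℂ) := by fun_prop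
  have cV : Continuous fun p : S.source × closedBall (0 : ℂ) 1 => p.1.1.2 := by fun_prop
  have cR : Continuous fun p : S.source × closedBall (0 : ℂ) 1 =>
      (1 - (p.2 : ℂ) • S.X p.1.1.1)⁻¹ :=
    continuous_matrix_inv (continuous_const.sub (cζ.smul cX)) fun p =>
      isUnit_one_sub_smul (S.isRegular _ (hmem p)).norm_lt (mem_closedBall_zero_iff.1 p.2.2)
  have cM : Continuous fun p : S.source × closedBall (0 : ℂ) 1 =>
      middle A b p.1.1.1 (S.X p.1.1.1) := by
    have h1 : Continuous fun a : Fin d → ℂ => coeffA A b a := by unfold coeffA; fun_prop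
    have h2 : Continuous fun a : Fin d → ℂ => coeffP A a := by unfold coeffP; fun_prop
    exact (h1.comp hfst).add ((h2.comp hfst).mul cX)
  have cW : Continuous fun p : S.source × closedBall (0 : ℂ) 1 =>
      (1 - S.X p.1.1.1) *ᵥ p.1.1.2 := (continuous_const.sub cX).matrix_mulVec cV
  have key : Continuous fun p : S.source × closedBall (0 : ℂ) 1 =>
      liftFun A b p.1.1.1 (S.X p.1.1.1) (S.K p.1.1.1) p.1.1.2 p.2 := by
    refine Continuous.prodMk (Continuous.prodMk ?_ (continuous_pi fun j => ?_))
      (Continuous.prodMk ?_ (continuous_pi fun j => ?_))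
    · exact (continuous_const.sub cζ).smul (cR.matrix_mulVec cW)
    · exact (continuous_const.sub cζ).smul (continuous_const.mul (cW.star.dotProduct
        ((((continuous_apply j).comp cK).mul (continuous_const.sub cX)).matrix_mulVec
          (cR.matrix_mulVec cW))))
    · exact (continuous_const.sub cζ).smul
        (cW.star.matrix_vecMul (cM.mul (continuous_const.sub (cζ.smul cX))))
    · fun_prop
  exact (ContinuousMap.curry ⟨_, key⟩).continuous

/-- The parameters `(a, V)` of a pointed lift. -/
def params (F : pointedLifts A b) : (Fin d → ℂ) × (Fin n → ℂ) :=
  (fun j => 2 * (discExtend F.1 0).2.2 j,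
   (1 - S.X fun j => 2 * (discExtend F.1 0).2.2 j)⁻¹ *ᵥ (discExtend F.1 0).1.1)

theorem continuous_discExtend_zero :
    Continuous fun F : pointedLifts A b => discExtend (F : DiscMap n d) 0 := by
  have h0 : (0 : ℂ) ∈ closedBall (0 : ℂ) 1 := by simp
  simp_rw [discExtend_of_mem _ h0]
  exact (continuous_eval_const _).comp continuous_subtype_val

theorem isOpen_params_base :
    IsOpen {F : pointedLifts A b | (S.params F).1 ∈ S.base} := by
  refine S.isOpen_base.preimage ?_
  have := continuous_discExtend_zero (A := A) (b := b)
  unfold params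
  fun_prop

theorem continuousOn_params :
    ContinuousOn S.params {F : pointedLifts A b | (S.params F).1 ∈ S.base} := by
  have h0 := continuous_discExtend_zero (A := A) (b := b)
  rw [continuousOn_iff_continuous_domRestrict]
  have c1 : Continuous fun F : {F : pointedLifts A b | (S.params F).1 ∈ S.base} =>
      discExtend (F.1 : DiscMap n d) 0 := h0.comp continuous_subtype_val
  have c2 : Continuous fun F : {F : pointedLifts A b | (S.params F).1 ∈ S.base} =>
      (S.params F.1).1 := by
    unfold params
    fun_prop
  have c3 := S.continuousOn_X.comp_continuous c2 fun F => F.2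
  refine c2.prodMk ((continuous_matrix_inv (continuous_const.sub c3) fun F =>
    isUnit_one_sub (S.isRegular _ F.2).norm_lt).matrix_mulVec ?_)
  fun_prop

theorem lift_mem (hA : ∀ j, (A j).IsHermitian) (q : S.source) : S.lift q ∈ pointedLifts A b :=
  liftMap_mem_pointedLifts hA (S.isRegular _ q.2.1) (S.stein_eq _ q.2.1) q.2.2

theorem params_lift (hA : ∀ j, (A j).IsHermitian) (q : S.source) :
    S.params ⟨S.lift q, S.lift_mem hA q⟩ = q := by
  have hX := (S.isRegular _ q.2.1).norm_lt
  have hu := (Matrix.isUnit_iff_isUnit_det _).1 (isUnit_one_sub hX)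
  have h0 : discExtend (S.lift q) 0 = _ := discExtend_liftMap hX (by simp)
  have h1 : (fun j => 2 * (discExtend (S.lift q) 0).2.2 j) = q.1.1 := by
    ext j
    rw [h0, liftFun_apply_zero.2]
    ring
  refine Prod.ext h1 ?_
  simp only [params]
  rw [h1, h0, liftFun_apply_zero.1, Matrix.mulVec_mulVec, Matrix.nonsing_inv_mul _ hu,
    Matrix.one_mulVec]

theorem lift_params (hA : ∀ j, (A j).IsHermitian) (F : pointedLifts A b)
    (hF : S.params F ∈ S.source) : S.lift ⟨S.params F, hF⟩ = F := by
  have hX := (S.isRegular _ hF.1).norm_lt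
  have hu := (Matrix.isUnit_iff_isUnit_det _).1 (isUnit_one_sub hX)
  refine eq_liftMap_of_mem_pointedLifts hA F.2 (fun j => rfl) (S.isRegular _ hF.1)
    (S.stein_eq _ hF.1) hF.2 ?_
  simp only [params] at hu ⊢
  rw [Matrix.mulVec_mulVec, Matrix.mul_nonsing_inv _ hu, Matrix.one_mulVec]

open Classical in
/-- The chart of the space of pointed lifts given by the parameters. -/
def chart (hA : ∀ j, (A j).IsHermitian) (q₀ : S.source) :
    OpenPartialHomeomorph ((Fin d → ℂ) × (Fin n → ℂ)) (pointedLifts A b) where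
  toFun q := if h : q ∈ S.source then ⟨S.lift ⟨q, h⟩, S.lift_mem hA _⟩
    -- A default value outside the source; it plays no role there.
    else ⟨S.lift q₀, S.lift_mem hA _⟩
  invFun := S.params
  source := S.source
  target := {F | S.params F ∈ S.source}
  map_source' q hq := by
    simp only [dif_pos hq]
    change S.params _ ∈ S.source
    rwa [S.params_lift hA ⟨q, hq⟩]
  map_target' F hF := hF
  left_inv' q hq := by
    simp only [dif_pos hq]
    exact S.params_lift hA ⟨q, hq⟩
  right_inv' F hF := by
    simp only [dif_pos (show S.params F ∈ S.source from hF)]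
    exact Subtype.ext (S.lift_params hA F hF)
  open_source := S.isOpen_source
  open_target := by
    -- The solution `X` is controlled only over the base, so openness is obtained in two stages:
    -- first the lifts with `a` in the base, then those with `V ≠ 0`.
    have := S.continuousOn_params.isOpen_inter_preimage S.isOpen_params_base S.isOpen_source
    convert this using 1
    ext F
    exact ⟨fun h => ⟨h.1, h⟩, fun h => h.2⟩
  continuousOn_toFun := by
    rw [continuousOn_iff_continuous_domRestrict]
    refine (S.continuous_lift.subtype_mk (S.lift_mem hA)).congr fun q => ?_
    simp [Set.domRestrict]
  continuousOn_invFun := S.continuousOn_params.mono fun F hF => hF.1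

theorem chart_apply (hA : ∀ j, (A j).IsHermitian) (q₀ : S.source)
    {q : (Fin d → ℂ) × (Fin n → ℂ)} (hq : q ∈ S.source) :
    (S.chart hA q₀ q : DiscMap n d) = S.lift ⟨q, hq⟩ := by
  have : S.chart hA q₀ q = ⟨S.lift ⟨q, hq⟩, S.lift_mem hA _⟩ := dif_pos hq
  rw [this]

theorem hasParameters_chart (hA : ∀ j, (A j).IsHermitian) (q₀ : S.source)
    {q : (Fin d → ℂ) × (Fin n → ℂ)} (hq : q ∈ S.source) :
    HasParameters A b (S.chart hA q₀ q) q := by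
  rw [chart_apply S hA q₀ hq]
  exact ⟨S.X q.1, (S.isRegular _ hq.1).isSmallSolution hA, fun ζ => ⟨rfl, fun j => rfl⟩⟩

/-- The `1`-jet map in the parameters `(a, V)`. -/
def jet (q : (Fin d → ℂ) × (Fin n → ℂ)) : (Fin n → ℂ) × (Fin d → ℝ) × (Fin d → ℝ) :=
  (-q.2, fun j => -2 * (star ((1 - S.X q.1) *ᵥ q.2) ⬝ᵥ
    S.K q.1 j *ᵥ ((1 - S.X q.1) *ᵥ q.2)).re, fun j => -(q.1 j).im)

theorem hasDerivWithinAt_chart (hA : ∀ j, (A j).IsHermitian) (q₀ : S.source)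
    {q : (Fin d → ℂ) × (Fin n → ℂ)} (hq : q ∈ S.source) :
    HasDerivWithinAt (discExtend (S.chart hA q₀ q : DiscMap n d))
      (jetInclusion A b (S.jet q)) (closedBall 0 1) 1 := by
  rw [chart_apply S hA q₀ hq]
  have hr := S.isRegular _ hq.1
  refine (liftMap_hasDerivWithinAt_one hr.norm_lt).congr_deriv ?_
  refine Prod.ext (Prod.ext rfl (funext fun j => ?_)) (Prod.ext ?_ (funext fun j => ?_))
  -- As `K_j` is Hermitian, `g_j'(1) = -2 W* K_j W` is real, as the real coordinate `t` requires.
  · have hK := isHermitian_of_stein hr.norm_lt (hA j) (S.stein_eq _ hq.1 j)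
    have h1 := star_dotProduct_mulVec ((1 - S.X q.1) *ᵥ q.2) ((1 - S.X q.1) *ᵥ q.2) (S.K q.1 j)
    rw [hK.eq] at h1
    have h2 := Complex.conj_eq_iff_real.1 h1
    obtain ⟨r, hr⟩ := h2
    simp only [jetInclusion, jet]
    rw [hr]
    simp
  · simp only [jetInclusion, jet]
    rw [pencil_eq hA hr.eq hr.norm_lt, Matrix.star_mulVec, Matrix.vecMul_vecMul, star_neg,
      Matrix.neg_vecMul, mul_assoc]
  · simp only [jetInclusion, jet]
    apply Complex.ext
    · simp
    · simp

end SolutionFamily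

end Chart

end

/-! ### Analytic dependence of `X` and `K_j` on `a`. -/

noncomputable section

section Smoothness

open scoped Matrix.Norms.L2Operator ContDiff Topology
open Metric

variable {n d : ℕ} {A : Fin d → Matrix (Fin n) (Fin n) ℂ} {b : Fin d → ℝ}

theorem contDiff_coeffP : ContDiff ℝ ω (coeffP A) := by
  unfold coeffP; fun_prop

theorem contDiff_conjTranspose :
    ContDiff ℝ ω (fun X : Matrix (Fin n) (Fin n) ℂ => Xᴴ) :=
  (starL' ℝ : Matrix (Fin n) (Fin n) ℂ ≃L[ℝ] Matrix (Fin n) (Fin n) ℂ).contDiff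

theorem contDiff_coeffA : ContDiff ℝ ω (coeffA A b) := by
  have : ∀ j, ContDiff ℝ ω (fun a : Fin d → ℂ => star (a j)) := fun j =>
    (starL' ℝ : ℂ ≃L[ℝ] ℂ).contDiff.comp (contDiff_apply ℝ ℂ j)
  unfold coeffA; fun_prop

/-- The matrix equation for `X` together with the Stein equations for the `K_j`. -/
def system (A : Fin d → Matrix (Fin n) (Fin n) ℂ) (b : Fin d → ℝ)
    (u : (Fin d → ℂ) × (Matrix (Fin n) (Fin n) ℂ × (Fin d → Matrix (Fin n) (Fin n) ℂ))) :
    Matrix (Fin n) (Fin n) ℂ × (Fin d → Matrix (Fin n) (Fin n) ℂ) :=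
  (coeffP A u.1 * u.2.1 ^ 2 + coeffA A b u.1 * u.2.1 + (coeffP A u.1)ᴴ,
   fun j => u.2.2 j - u.2.1ᴴ * u.2.2 j * u.2.1 - A j)

/-- Analyticity is over `ℝ`, because `ā` and `X*` occur. -/
theorem contDiff_system : ContDiff ℝ ω (system A b) := by
  have h1 : ContDiff ℝ ω fun u : (Fin d → ℂ) × (Matrix (Fin n) (Fin n) ℂ ×
    (Fin d → Matrix (Fin n) (Fin n) ℂ)) => coeffP A u.1 := contDiff_coeffP.comp contDiff_fst
  have h2 : ContDiff ℝ ω fun u : (Fin d → ℂ) × (Matrix (Fin n) (Fin n) ℂ ×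
    (Fin d → Matrix (Fin n) (Fin n) ℂ)) => coeffA A b u.1 := contDiff_coeffA.comp contDiff_fst
  have h3 : ContDiff ℝ ω fun u : (Fin d → ℂ) × (Matrix (Fin n) (Fin n) ℂ ×
    (Fin d → Matrix (Fin n) (Fin n) ℂ)) => (coeffP A u.1)ᴴ := contDiff_conjTranspose.comp h1
  have h4 : ContDiff ℝ ω fun u : (Fin d → ℂ) × (Matrix (Fin n) (Fin n) ℂ ×
    (Fin d → Matrix (Fin n) (Fin n) ℂ)) => u.2.1ᴴ :=
    contDiff_conjTranspose.comp (contDiff_fst.comp contDiff_snd)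
  unfold system
  fun_prop

theorem hasDerivAt_coeffP {c : ℝ → Fin d → ℂ} {α : Fin d → ℂ} {s : ℝ} (hc : HasDerivAt c α s) :
    HasDerivAt (fun s => coeffP A (c s)) (coeffP A α) s := by
  unfold coeffP
  exact HasDerivAt.fun_sum fun j _ => ((hasDerivAt_pi.1 hc j).smul_const (A j))

theorem hasDerivAt_coeffA {c : ℝ → Fin d → ℂ} {α : Fin d → ℂ} {s : ℝ} (hc : HasDerivAt c α s) :
    HasDerivAt (fun s => coeffA A b (c s)) (coeffA A 0 α) s := by
  unfold coeffA
  refine HasDerivAt.fun_sum fun j _ => ?_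
  have h1 := hasDerivAt_pi.1 hc j
  have h2 := ((h1.const_sub (b j : ℂ)).sub h1.star).smul_const (A j)
  simpa using h2

theorem hasDerivAt_system {c : ℝ → Fin d → ℂ} {x : ℝ → Matrix (Fin n) (Fin n) ℂ}
    {k : ℝ → Fin d → Matrix (Fin n) (Fin n) ℂ} {α : Fin d → ℂ} {Y : Matrix (Fin n) (Fin n) ℂ}
    {L : Fin d → Matrix (Fin n) (Fin n) ℂ} {s : ℝ} (hc : HasDerivAt c α s)
    (hx : HasDerivAt x Y s) (hk : HasDerivAt k L s) :
    HasDerivAt (fun s => system A b (c s, (x s, k s)))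
      (coeffP A α * x s ^ 2 + coeffP A (c s) * (Y * x s + x s * Y) +
        (coeffA A 0 α * x s + coeffA A b (c s) * Y) + (coeffP A α)ᴴ,
       fun j => L j - ((Yᴴ * k s j + (x s)ᴴ * L j) * x s + (x s)ᴴ * k s j * Y)) s := by
  refine HasDerivAt.prodMk ?_ (hasDerivAt_pi.2 fun j => ?_)
  · have h1 := ((((hasDerivAt_coeffP (A := A) hc).mul (hx.mul hx))).add
      ((hasDerivAt_coeffA (A := A) (b := b) hc).mul hx)).add (hasDerivAt_coeffP (A := A) hc).star
    simpa only [pow_two] using! h1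
  · have hkj := hasDerivAt_pi.1 hk j
    have h1 := (hkj.sub ((hx.star.mul hkj).mul hx)).sub_const (A j)
    exact h1

/-- The partial derivative is block triangular. Its `X`-part is `Y ↦ PYX + QY`, which equals `stein
X (Q Y)` because `P = -X* Q`; for `Y = 0` its `K`-part is `stein X` in each component. Injectivity
suffices by finite dimension. -/
theorem system_partial_isInvertible (hA : ∀ j, (A j).IsHermitian) {a : Fin d → ℂ}
    {X : Matrix (Fin n) (Fin n) ℂ} (h : IsRegularSolution A b a X)
    (K : Fin d → Matrix (Fin n) (Fin n) ℂ) :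
    (fderiv ℝ (system A b) (a, (X, K)) ∘L .inr ℝ (Fin d → ℂ) (Matrix (Fin n) (Fin n) ℂ ×
      (Fin d → Matrix (Fin n) (Fin n) ℂ))).IsInvertible := by
  set T := fderiv ℝ (system A b) (a, (X, K)) ∘L .inr ℝ (Fin d → ℂ) (Matrix (Fin n) (Fin n) ℂ ×
      (Fin d → Matrix (Fin n) (Fin n) ℂ)) with hT
  have hval : ∀ Y L, T (Y, L) = (coeffP A a * (Y * X + X * Y) + coeffA A b a * Y,
      fun j => L j - ((Yᴴ * K j + Xᴴ * L j) * X + Xᴴ * K j * Y)) := by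
    intro Y L
    have hd : DifferentiableAt ℝ (system A b) (a, (X, K)) :=
      contDiff_system.contDiffAt.differentiableAt (by simp)
    have hline : HasDerivAt (fun s : ℝ => ((a, (X, K)) + s • ((0 : Fin d → ℂ), (Y, L)) :
        (Fin d → ℂ) × (Matrix (Fin n) (Fin n) ℂ × (Fin d → Matrix (Fin n) (Fin n) ℂ))))
        (0, (Y, L)) 0 := by
      simpa using ((hasDerivAt_id (0 : ℝ)).smul_const ((0 : Fin d → ℂ), (Y, L))).const_add
        (a, (X, K))
    have h1 : HasDerivAt (fun s : ℝ => system A b ((a, (X, K)) + s • ((0 : Fin d → ℂ), (Y, L))))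
        (fderiv ℝ (system A b) (a, (X, K)) (0, (Y, L))) 0 := by
      have h' : HasFDerivAt (system A b) (fderiv ℝ (system A b) (a, (X, K)))
          ((a, (X, K)) + (0 : ℝ) • ((0 : Fin d → ℂ), (Y, L))) := by
        rw [zero_smul, add_zero]; exact hd.hasFDerivAt
      exact h'.comp_hasDerivAt 0 hline
    have hx : HasDerivAt (fun s : ℝ => X + s • Y) Y 0 := by
      simpa using ((hasDerivAt_id (0 : ℝ)).smul_const Y).const_add X
    have hk : HasDerivAt (fun s : ℝ => K + s • L) L 0 := by
      simpa using ((hasDerivAt_id (0 : ℝ)).smul_const L).const_add K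
    have h2 := hasDerivAt_system (A := A) (b := b) (hasDerivAt_const (0 : ℝ) a) hx hk
    have h3 : (fun s : ℝ => system A b ((a, (X, K)) + s • ((0 : Fin d → ℂ), (Y, L)))) =
        fun s : ℝ => system A b (a, (X + s • Y, K + s • L)) := by
      funext s; simp
    rw [h3] at h1
    have := h1.unique h2
    rw [hT, ContinuousLinearMap.comp_apply, ContinuousLinearMap.inr_apply, this]
    simp [coeffP, coeffA]
  have hinj : Function.Injective T := by
    rw [injective_iff_map_eq_zero]
    rintro ⟨Y, L⟩ h0
    rw [hval] at h0
    have e1 := congrArg Prod.fst h0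
    have e2 := congrArg Prod.snd h0
    simp only [Prod.fst_zero, Prod.snd_zero] at e1 e2
    have hY : Y = 0 := by
      have : stein X (middle A b a X * Y) = 0 := by
        rw [stein_apply, ← e1, ← mul_assoc, ← neg_neg (Xᴴ * middle A b a X),
          ← coeffP_eq_neg hA h.eq h.norm_lt, middle]
        noncomm_ring
      have := stein_injective h.norm_lt (this.trans (map_zero _).symm)
      exact h.isUnit.mul_right_eq_zero.1 this
    have hL : L = 0 := by
      ext1 j
      have := congrFun e2 j
      simp only [hY, Matrix.conjTranspose_zero, zero_mul, zero_add, mul_zero, add_zero] at this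
      exact stein_injective h.norm_lt (this.trans (map_zero _).symm)
    rw [hY, hL]; rfl
  have hsurj : Function.Surjective T :=
    (LinearMap.injective_iff_surjective (f := T.toLinearMap)).1 hinj
  exact ⟨ContinuousLinearEquiv.ofBijective T (LinearMap.ker_eq_bot.2 hinj)
    (LinearMap.range_eq_top.2 hsurj), ContinuousLinearMap.ext fun v => rfl⟩

/-- A regular solution extends to an analytic family of regular solutions. -/
theorem exists_solutionFamily (hA : ∀ j, (A j).IsHermitian) {a₀ : Fin d → ℂ}
    {X₀ : Matrix (Fin n) (Fin n) ℂ} (h : IsRegularSolution A b a₀ X₀) :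
    ∃ S : SolutionFamily A b, a₀ ∈ S.base ∧ S.X a₀ = X₀ ∧
      ContDiffAt ℝ ω S.X a₀ ∧ ContDiffAt ℝ ω S.K a₀ := by
  choose K₀ hK₀ using fun j => stein_surjective h.norm_lt (A j)
  have cd : ContDiffAt ℝ ω (system A b) (a₀, (X₀, K₀)) := contDiff_system.contDiffAt
  have hω : (ω : ℕ∞ω) ≠ 0 := by simp
  have inv := system_partial_isInvertible hA h K₀
  let φ := cd.implicitFunction hω inv
  have hφ0 : φ a₀ = (X₀, K₀) := cd.implicitFunction_apply_self hω inv
  have hφc : ContDiffAt ℝ ω φ a₀ := cd.contDiffAt_implicitFunction hω inv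
  have hsys : system A b (a₀, (X₀, K₀)) = 0 := by
    refine Prod.ext h.eq (funext fun j => ?_)
    have := hK₀ j
    rw [stein_apply] at this
    simp [system, this]
  have ev1 : ∀ᶠ a in 𝓝 a₀, system A b (a, φ a) = 0 := by
    have := cd.eventually_apply_implicitFunction hω inv
    rw [hsys] at this
    exact this
  -- Analyticity at one point spreads to a neighbourhood, which smoothness of order `∞` at a point
  -- would not do.
  have ev2 : ∀ᶠ a in 𝓝 a₀, ContDiffAt ℝ ω φ a := hφc.eventually (by simp)
  have hc1 : ContinuousAt (fun a => (φ a).1) a₀ := hφc.continuousAt.fst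
  have ev3 : ∀ᶠ a in 𝓝 a₀, ‖(φ a).1‖ < 1 := by
    refine hc1.norm.eventually_lt continuousAt_const ?_
    rw [hφ0]; exact h.norm_lt
  have ev4 : ∀ᶠ a in 𝓝 a₀, IsUnit (middle A b a (φ a).1) := by
    have hm : ContinuousAt (fun a => middle A b a (φ a).1) a₀ :=
      (contDiff_coeffA.continuous.continuousAt).add
        ((contDiff_coeffP.continuous.continuousAt).mul hc1)
    refine hm.eventually (Units.isOpen.mem_nhds ?_)
    simp only [hφ0]
    exact h.isUnit
  obtain ⟨O, hO, hOo, haO⟩ := _root_.eventually_nhds_iff.1 (ev1.and (ev2.and (ev3.and ev4)))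
  have hcont : ContinuousOn φ O := fun a ha => (hO a ha).2.1.continuousAt.continuousWithinAt
  refine ⟨⟨O, hOo, fun a => (φ a).1, fun a => (φ a).2, hcont.fst, hcont.snd,
    fun a ha => ⟨congrArg Prod.fst (hO a ha).1, (hO a ha).2.2.1, (hO a ha).2.2.2⟩,
    fun a ha j => ?_⟩, haO, by simp only [hφ0], hφc.fst, hφc.snd⟩
  have := congrFun (congrArg Prod.snd (hO a ha).1) j
  exact sub_eq_zero.1 this

end Smoothness

end

/-! ### Inverse function theorem and the algebra of the jet derivative. -/

noncomputable section

section LocalDiffeomorphism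

open scoped Matrix.Norms.L2Operator ContDiff Topology Manifold
open Metric

/-- The inverse function theorem for analytic maps between finite-dimensional spaces of the same
dimension, in terms of local diffeomorphisms. -/
theorem isLocalDiffeomorphAt_of_injective_fderiv {E F : Type*} [NormedAddCommGroup E]
    [NormedSpace ℝ E] [FiniteDimensional ℝ E] [NormedAddCommGroup F] [NormedSpace ℝ F]
    [FiniteDimensional ℝ F] (hEF : Module.finrank ℝ E = Module.finrank ℝ F) {f : E → F} {x : E}
    (hf : ContDiffAt ℝ ω f x) (hinj : ∀ v, fderiv ℝ f x v = 0 → v = 0) :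
    IsLocalDiffeomorphAt 𝓘(ℝ, E) 𝓘(ℝ, F) ∞ f x := by
  have : CompleteSpace E := FiniteDimensional.complete ℝ E
  have : CompleteSpace F := FiniteDimensional.complete ℝ F
  have hω : (ω : ℕ∞ω) ≠ 0 := by simp
  have hi : Function.Injective (fderiv ℝ f x) := (injective_iff_map_eq_zero _).2 hinj
  have hs : Function.Surjective (fderiv ℝ f x) :=
    (LinearMap.injective_iff_surjective_of_finrank_eq_finrank hEF
      (f := (fderiv ℝ f x).toLinearMap)).1 hi
  let f' : E ≃L[ℝ] F := ContinuousLinearEquiv.ofBijective (fderiv ℝ f x)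
    (LinearMap.ker_eq_bot.2 hi) (LinearMap.range_eq_top.2 hs)
  have hf' : HasFDerivAt f (f' : E →L[ℝ] F) x := by
    have : (f' : E →L[ℝ] F) = fderiv ℝ f x := by ext v; rfl
    rw [this]
    exact (hf.differentiableAt hω).hasFDerivAt
  let e := hf.toOpenPartialHomeomorph f hf' hω
  have hxe : x ∈ e.source := hf.mem_toOpenPartialHomeomorph_source hf' hω
  have hsymm : ContDiffAt ℝ ω e.symm (f x) := hf.to_localInverse hf' hω
  have ev1 : ∀ᶠ y in 𝓝 x, ContDiffAt ℝ ω f y := hf.eventually (by simp)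
  have ev2 : ∀ᶠ y in 𝓝 x, ContDiffAt ℝ ω e.symm (f y) :=
    hf.continuousAt.eventually (hsymm.eventually (by simp))
  obtain ⟨O, hO, hOo, hxO⟩ := _root_.eventually_nhds_iff.1 (ev1.and ev2)
  let e' := e.restrOpen O hOo
  have hsrc : ∀ y ∈ e'.source, y ∈ O := fun y hy => hy.2
  refine ⟨⟨e'.toPartialEquiv, e'.open_source, e'.open_target, ?_, ?_⟩, ⟨hxe, hxO⟩, fun y _ => rfl⟩
  · refine ContDiffOn.contMDiffOn fun y hy => ?_
    exact ((hO y (hsrc y hy)).1.of_le le_top).contDiffWithinAt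
  · refine ContDiffOn.contMDiffOn fun y hy => ?_
    have h1 := e'.map_target hy
    have h2 := (hO _ (hsrc _ h1)).2
    have h3 : f (e'.symm y) = y := e'.right_inv hy
    rw [h3] at h2
    exact (h2.of_le le_top).contDiffWithinAt

variable {n d : ℕ} {A : Fin d → Matrix (Fin n) (Fin n) ℂ} {b : Fin d → ℝ}

/-- The derivative of `(I - ᵗX̄) K (I - X)` in the direction of a real parameter. -/
theorem deriv_quadratic_eq {X Q B K KB G Y L : Matrix (Fin n) (Fin n) ℂ} (hX : ‖X‖ < 1)
    (hQ : IsUnit Q) (hK : K.IsHermitian) (hKB : stein X KB = B)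
    (hG : stein X G = K * Q⁻¹ * KB)
    (hY : stein X (Q * Y) = -(B * (1 - X) ^ 2))
    (hL : stein X L = Yᴴ * K * X + Xᴴ * K * Y) :
    (1 - X)ᴴ * L * (1 - X) - Yᴴ * K * (1 - X) - (1 - X)ᴴ * K * Y =
      ((1 - X) ^ 2)ᴴ * G * (1 - X) ^ 2 + (((1 - X) ^ 2)ᴴ * G * (1 - X) ^ 2)ᴴ := by
  -- `X` commutes with `(1 - X)²`, so multiplying the solution `KB` on the right by it solves the
  -- multiplied equation.
  have hQY : Q * Y = -(KB * (1 - X) ^ 2) := by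
    apply stein_injective hX
    rw [hY, ← hKB, stein_apply, stein_apply]
    noncomm_ring
  have hY' : Y = -(Q⁻¹ * KB * (1 - X) ^ 2) := by
    have hu := (Matrix.isUnit_iff_isUnit_det _).1 hQ
    calc Y = Q⁻¹ * (Q * Y) := by rw [← mul_assoc, Matrix.nonsing_inv_mul _ hu, one_mul]
      _ = _ := by rw [hQY]; noncomm_ring
  have hKY : K * Y = -((G - Xᴴ * G * X) * (1 - X) ^ 2) := by
    rw [← stein_apply, hG, hY']
    noncomm_ring
  have hM : stein X (-(Xᴴ * G * (1 - X) ^ 2)) = Xᴴ * K * Y := by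
    rw [mul_assoc Xᴴ K Y, hKY, stein_apply]
    noncomm_ring
  -- The right-hand side of the equation for `L` is a matrix plus its adjoint. By `hM`, half of it
  -- has the explicit preimage `-X* G (1 - X)²`.
  have hL' : L = -(Xᴴ * G * (1 - X) ^ 2) + (-(Xᴴ * G * (1 - X) ^ 2))ᴴ := by
    apply stein_injective hX
    rw [hL, map_add, stein_conjTranspose, hM, add_comm]
    simp [hK.eq, mul_assoc]
  -- After taking out `(1 - X)*` and `(1 - X)²`, the middle factor is `-X* G (1 - X) + G - X* G X =
  -- (1 - X*) G`.
  have hT : (1 - X)ᴴ * (-(Xᴴ * G * (1 - X) ^ 2)) * (1 - X) - (1 - X)ᴴ * K * Y =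
      ((1 - X) ^ 2)ᴴ * G * (1 - X) ^ 2 := by
    rw [mul_assoc _ K Y, hKY, Matrix.conjTranspose_pow, Matrix.conjTranspose_sub,
      Matrix.conjTranspose_one]
    noncomm_ring
  have hT' := congrArg Matrix.conjTranspose hT
  rw [← hT', ← hT, hL']
  simp only [Matrix.conjTranspose_sub, Matrix.conjTranspose_mul, Matrix.conjTranspose_neg, hK.eq,
    Matrix.conjTranspose_conjTranspose]
  noncomm_ring

theorem contDiff_entry (i j : Fin n) :
    ContDiff ℝ ω (fun M : Matrix (Fin n) (Fin n) ℂ => M i j) :=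
  ((entryCLM i j).restrictScalars ℝ).contDiff

theorem contDiff_mulVec : ContDiff ℝ ω
    (fun p : Matrix (Fin n) (Fin n) ℂ × (Fin n → ℂ) => p.1 *ᵥ p.2) := by
  refine contDiff_pi.2 fun i => ?_
  change ContDiff ℝ ω fun p : Matrix (Fin n) (Fin n) ℂ × (Fin n → ℂ) => ∑ j, p.1 i j * p.2 j
  refine ContDiff.sum fun j _ => ?_
  exact ((contDiff_entry i j).comp contDiff_fst).mul ((contDiff_apply ℝ ℂ j).comp contDiff_snd)

theorem contDiff_hermitianForm : ContDiff ℝ ω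
    (fun p : (Fin n → ℂ) × (Fin n → ℂ) => (star p.1 ⬝ᵥ p.2).re) := by
  have h1 : ∀ j, ContDiff ℝ ω fun p : (Fin n → ℂ) × (Fin n → ℂ) => star (p.1 j) := fun j =>
    (starL' ℝ : ℂ ≃L[ℝ] ℂ).contDiff.comp ((contDiff_apply ℝ ℂ j).comp contDiff_fst)
  have h2 : ContDiff ℝ ω fun p : (Fin n → ℂ) × (Fin n → ℂ) => ∑ j, star (p.1 j) * p.2 j := by
    fun_prop
  exact Complex.reCLM.contDiff.comp h2

theorem SolutionFamily.contDiffAt_jet (S : SolutionFamily A b) {a₀ : Fin d → ℂ} (V₀ : Fin n → ℂ)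
    (hX : ContDiffAt ℝ ω S.X a₀) (hK : ContDiffAt ℝ ω S.K a₀) :
    ContDiffAt ℝ ω S.jet (a₀, V₀) := by
  have hX' : ContDiffAt ℝ ω (fun q : (Fin d → ℂ) × (Fin n → ℂ) => S.X q.1) (a₀, V₀) :=
    ContDiffAt.comp (a₀, V₀) hX contDiffAt_fst
  have hK' : ContDiffAt ℝ ω (fun q : (Fin d → ℂ) × (Fin n → ℂ) => S.K q.1) (a₀, V₀) :=
    ContDiffAt.comp (a₀, V₀) hK contDiffAt_fst
  have hW : ContDiffAt ℝ ω (fun q : (Fin d → ℂ) × (Fin n → ℂ) => (1 - S.X q.1) *ᵥ q.2)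
      (a₀, V₀) :=
    ContDiffAt.comp (a₀, V₀) contDiff_mulVec.contDiffAt
      ((contDiffAt_const.sub hX').prodMk contDiffAt_snd)
  refine contDiffAt_snd.neg.prodMk ((contDiffAt_pi.2 fun j => ?_).prodMk
    (contDiffAt_pi.2 fun j => ?_))
  · have hKW : ContDiffAt ℝ ω (fun q : (Fin d → ℂ) × (Fin n → ℂ) =>
        S.K q.1 j *ᵥ ((1 - S.X q.1) *ᵥ q.2)) (a₀, V₀) :=
      ContDiffAt.comp (a₀, V₀) contDiff_mulVec.contDiffAt ((contDiffAt_pi.1 hK' j).prodMk hW)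
    have hform := ContDiffAt.comp (a₀, V₀)
      (contDiff_hermitianForm (n := n)).contDiffAt (hW.prodMk hKW)
    exact contDiffAt_const.mul hform
  · have : ContDiff ℝ ω fun q : (Fin d → ℂ) × (Fin n → ℂ) => (q.1 j).im :=
      Complex.imCLM.contDiff.comp ((contDiff_apply ℝ ℂ j).comp contDiff_fst)
    exact this.neg.contDiffAt

theorem hasDerivAt_hermitianForm {M : ℝ → Matrix (Fin n) (Fin n) ℂ}
    {M' : Matrix (Fin n) (Fin n) ℂ} {s : ℝ} (hM : HasDerivAt M M' s) (v : Fin n → ℂ) :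
    HasDerivAt (fun s => (star v ⬝ᵥ M s *ᵥ v).re) (star v ⬝ᵥ M' *ᵥ v).re s := by
  have hij : ∀ i j, HasDerivAt (fun s => M s i j) (M' i j) s := fun i j =>
    ((entryCLM i j).restrictScalars ℝ).hasFDerivAt.comp_hasDerivAt s hM
  have h1 : HasDerivAt (fun s => ∑ i, star (v i) * ∑ j, M s i j * v j)
      (∑ i, star (v i) * ∑ j, M' i j * v j) s :=
    HasDerivAt.fun_sum fun i _ => (HasDerivAt.fun_sum fun j _ => (hij i j).mul_const _).const_mul _
  exact Complex.reCLM.hasFDerivAt.comp_hasDerivAt s h1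

end LocalDiffeomorphism

end

/-! ### The kernel of the derivative of the `1`-jet map. -/

noncomputable section

section JetDerivative

open scoped Matrix.Norms.L2Operator ContDiff Topology Manifold

variable {n d : ℕ} {A : Fin d → Matrix (Fin n) (Fin n) ℂ} {b : Fin d → ℝ}

theorem hasDerivAt_add_smul {E : Type*} [NormedAddCommGroup E] [NormedSpace ℝ E] (x v : E) :
    HasDerivAt (fun s : ℝ => x + s • v) v 0 := by
  simpa using ((hasDerivAt_id (0 : ℝ)).smul_const v).const_add x

theorem hasDerivAt_comp_add_smul {E F : Type*} [NormedAddCommGroup E] [NormedSpace ℝ E]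
    [NormedAddCommGroup F] [NormedSpace ℝ F] {f : E → F} {x : E} (hf : DifferentiableAt ℝ f x)
    (v : E) : HasDerivAt (fun s : ℝ => f (x + s • v)) (fderiv ℝ f x v) 0 := by
  have h1 : HasFDerivAt f (fderiv ℝ f x) (x + (0 : ℝ) • v) := by
    rw [zero_smul, add_zero]; exact hf.hasFDerivAt
  exact h1.comp_hasDerivAt 0 (hasDerivAt_add_smul x v)

namespace SolutionFamily

variable (S : SolutionFamily A b) {a₀ : Fin d → ℂ}

/-- The linearized equations satisfied by the derivatives of the solutions in the direction of a
real parameter. -/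
theorem exists_derivatives (hA : ∀ j, (A j).IsHermitian) (ha₀ : a₀ ∈ S.base)
    (hcX : ContDiffAt ℝ ω S.X a₀) (hcK : ContDiffAt ℝ ω S.K a₀) {α : Fin d → ℂ}
    (hα : ∀ j, star (α j) = α j) :
    ∃ Y L, HasDerivAt (fun s : ℝ => S.X (a₀ + s • α)) Y 0 ∧
      HasDerivAt (fun s : ℝ => S.K (a₀ + s • α)) L 0 ∧
      stein (S.X a₀) (middle A b a₀ (S.X a₀) * Y) = -(coeffP A α * (1 - S.X a₀) ^ 2) ∧
      ∀ j, stein (S.X a₀) (L j) = Yᴴ * S.K a₀ j * S.X a₀ + (S.X a₀)ᴴ * S.K a₀ j * Y := by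
  have hc := hasDerivAt_add_smul a₀ α
  have hc0 : a₀ + (0 : ℝ) • α = a₀ := by rw [zero_smul, add_zero]
  have h := S.isRegular _ ha₀
  have hY := hasDerivAt_comp_add_smul (hcX.differentiableAt (by simp)) α
  have hL := hasDerivAt_comp_add_smul (hcK.differentiableAt (by simp)) α
  generalize fderiv ℝ S.X a₀ α = Y at hY
  generalize fderiv ℝ S.K a₀ α = L at hL
  refine ⟨Y, L, hY, hL, ?_⟩
  have hzero : (fun s : ℝ => system A b (a₀ + s • α, (S.X (a₀ + s • α), S.K (a₀ + s • α))))
      =ᶠ[𝓝 0] fun _ => 0 := by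
    have h1 : ∀ᶠ s : ℝ in 𝓝 0, a₀ + s • α ∈ S.base :=
      hc.continuousAt.eventually (S.isOpen_base.mem_nhds (by simpa using ha₀))
    filter_upwards [h1] with s hs
    refine Prod.ext (S.isRegular _ hs).eq (funext fun j => ?_)
    have := S.stein_eq _ hs j
    rw [stein_apply] at this
    simp [system, this]
  have hsys := (hasDerivAt_system (A := A) (b := b) hc hY hL).unique
    ((hasDerivAt_const (0 : ℝ) _).congr_of_eventuallyEq hzero)
  simp only [hc0] at hsys
  have hsys1 := congrArg Prod.fst hsys
  have hsys2 := fun j => congrFun (congrArg Prod.snd hsys) j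
  simp only [Prod.fst_zero, Prod.snd_zero, Pi.zero_apply] at hsys1 hsys2
  generalize S.X a₀ = X at *
  have hB1 : (coeffP A α)ᴴ = coeffP A α := by
    rw [coeffP_conjTranspose hA, coeffP]
    simp only [hα]
  -- For real `α` the variations of `P`, `A`, `P*` are `B`, `-2B`, `B`, so the inhomogeneous term of
  -- the linearized equation is `B(1 - X)²`.
  have hB2 : coeffA A 0 α = -(2 • coeffP A α) := by
    rw [coeffA, coeffP, Finset.smul_sum, ← Finset.sum_neg_distrib]
    refine Finset.sum_congr rfl fun j _ => ?_
    rw [hα j, two_smul, ← add_smul, ← neg_smul]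
    congr 1
    simp
    ring
  constructor
  · rw [eq_neg_iff_add_eq_zero, ← hsys1, hB1, hB2, stein_apply, ← mul_assoc,
      ← neg_neg (Xᴴ * middle A b a₀ X), ← coeffP_eq_neg hA h.eq h.norm_lt, middle]
    noncomm_ring
  · intro j
    rw [stein_apply, ← sub_eq_zero, ← hsys2 j]
    noncomm_ring

theorem hasDerivAt_jet_snd_fst {α : Fin d → ℂ} {Y : Matrix (Fin n) (Fin n) ℂ}
    {L : Fin d → Matrix (Fin n) (Fin n) ℂ}
    (hY : HasDerivAt (fun s : ℝ => S.X (a₀ + s • α)) Y 0)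
    (hL : HasDerivAt (fun s : ℝ => S.K (a₀ + s • α)) L 0) (V : Fin n → ℂ) (j : Fin d) :
    HasDerivAt (fun s : ℝ => (S.jet (a₀ + s • α, V)).2.1 j)
      (-2 * (star V ⬝ᵥ ((1 - S.X a₀)ᴴ * L j * (1 - S.X a₀) - Yᴴ * S.K a₀ j * (1 - S.X a₀) -
        (1 - S.X a₀)ᴴ * S.K a₀ j * Y) *ᵥ V).re) 0 := by
  have hc0 : a₀ + (0 : ℝ) • α = a₀ := by rw [zero_smul, add_zero]
  have d1 : HasDerivAt (fun s : ℝ => (1 - S.X (a₀ + s • α))ᴴ * S.K (a₀ + s • α) j *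
      (1 - S.X (a₀ + s • α)))
      ((1 - S.X a₀)ᴴ * L j * (1 - S.X a₀) - Yᴴ * S.K a₀ j * (1 - S.X a₀) -
        (1 - S.X a₀)ᴴ * S.K a₀ j * Y) 0 := by
    have h1 : HasDerivAt (fun s : ℝ => 1 - S.X (a₀ + s • α)) (-Y) 0 := hY.const_sub 1
    have h2 := (h1.star.mul (hasDerivAt_pi.1 hL j)).mul h1
    refine h2.congr_deriv ?_
    simp only [hc0, star_neg, Matrix.star_eq_conjTranspose, Pi.mul_apply]
    noncomm_ring
  have d2 := (hasDerivAt_hermitianForm d1 V).const_mul (-2)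
  refine d2.congr_of_eventuallyEq (Filter.Eventually.of_forall fun s => ?_)
  simp only [SolutionFamily.jet]
  rw [Matrix.star_mulVec, ← Matrix.dotProduct_mulVec, Matrix.mulVec_mulVec,
    Matrix.mulVec_mulVec, mul_assoc]

end SolutionFamily

/-- If `Re (ᵗŪ G_{j,s} U)` is an invertible matrix, where `U = (I - X)² V` and `G_{j,s}` solves the
Stein equation with right-hand side `K_j (A + P X)⁻¹ K_s`, then the `1`-jet map is a local
diffeomorphism. -/
theorem oneJetIsLocalDiffeoAt_of_regular (hA : ∀ j, (A j).IsHermitian) {a₀ : Fin d → ℂ}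
    {X : Matrix (Fin n) (Fin n) ℂ} (h : IsRegularSolution A b a₀ X)
    {K : Fin d → Matrix (Fin n) (Fin n) ℂ} (hK : ∀ j, stein X (K j) = A j)
    {V₀ : Fin n → ℂ} (hV₀ : V₀ ≠ 0)
    (hnd : ∀ α : Fin d → ℝ,
      (∀ j G, stein X G = K j * (middle A b a₀ X)⁻¹ * ∑ s, (α s : ℂ) • K s →
        (star ((1 - X) ^ 2 *ᵥ V₀) ⬝ᵥ G *ᵥ ((1 - X) ^ 2 *ᵥ V₀)).re = 0) → α = 0) :
    OneJetIsLocalDiffeoAt A b (a₀, V₀) := by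
  obtain ⟨S, ha₀, rfl, hcX, hcK⟩ := exists_solutionFamily hA h
  have hX := h.norm_lt
  have hSK : S.K a₀ = K := by
    ext1 j
    apply stein_injective hX
    rw [hK j, S.stein_eq _ ha₀]
  subst hSK
  refine ⟨S.chart hA ⟨(a₀, V₀), ha₀, hV₀⟩, ⟨ha₀, hV₀⟩, fun q hq => S.hasParameters_chart hA _ hq,
    S.jet, fun q hq => S.hasDerivWithinAt_chart hA _ hq, ?_⟩
  have hjet := S.contDiffAt_jet V₀ hcX hcK
  refine isLocalDiffeomorphAt_of_injective_fderiv ?_ hjet ?_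
  · simp [Module.finrank_prod, Module.finrank_pi_fintype, Complex.finrank_real_complex]
    ring
  rintro ⟨α, W⟩ h0
  have hder := hasDerivAt_comp_add_smul (hjet.differentiableAt (by simp)) (α, W)
  rw [h0] at hder
  have hd1 : HasDerivAt (fun s : ℝ => -(V₀ + s • W)) 0 0 :=
    (ContinuousLinearMap.fst ℝ (Fin n → ℂ) ((Fin d → ℝ) × (Fin d → ℝ))).hasFDerivAt.comp_hasDerivAt
      (0 : ℝ) hder
  have hd2 : HasDerivAt (fun s : ℝ => (S.jet (a₀ + s • α, V₀ + s • W)).2) 0 0 :=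
    (ContinuousLinearMap.snd ℝ (Fin n → ℂ) ((Fin d → ℝ) × (Fin d → ℝ))).hasFDerivAt.comp_hasDerivAt
      (0 : ℝ) hder
  have hd3 : HasDerivAt (fun s : ℝ => (S.jet (a₀ + s • α, V₀ + s • W)).2.1) 0 0 :=
    (ContinuousLinearMap.fst ℝ (Fin d → ℝ) (Fin d → ℝ)).hasFDerivAt.comp_hasDerivAt (0 : ℝ) hd2
  have hd4 : HasDerivAt (fun s : ℝ => fun j => -((a₀ + s • α) j).im) 0 0 :=
    (ContinuousLinearMap.snd ℝ (Fin d → ℝ) (Fin d → ℝ)).hasFDerivAt.comp_hasDerivAt (0 : ℝ) hd2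
  -- The outer components `-V` and `-Im a` of the jet leave only real variations of `a` in the
  -- kernel.
  have hW : W = 0 := neg_eq_zero.1 ((hasDerivAt_add_smul V₀ W).neg.unique hd1)
  have him : ∀ j, (α j).im = 0 := fun j => by
    have h1 := (Complex.imCLM.hasFDerivAt.comp_hasDerivAt (0 : ℝ)
      (hasDerivAt_pi.1 (hasDerivAt_add_smul a₀ α) j)).neg
    exact neg_eq_zero.1 (h1.unique (hasDerivAt_pi.1 hd4 j))
  have hα : ∀ j, α j = ((α j).re : ℂ) := fun j => Complex.ext rfl (by simp [him j])
  have hα' : ∀ j, star (α j) = α j := fun j => by rw [hα j]; simp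
  subst hW
  simp only [smul_zero, add_zero] at hd3
  obtain ⟨Y, L, hY, hL, hQY, hLj⟩ := S.exists_derivatives hA ha₀ hcX hcK hα'
  have hKB : stein (S.X a₀) (∑ s, ((α s).re : ℂ) • S.K a₀ s) = coeffP A α := by
    rw [map_sum, coeffP]
    refine Finset.sum_congr rfl fun j _ => ?_
    rw [map_smul, hK, ← hα j]
  have hre : (fun j => (α j).re) = 0 := by
    refine hnd _ fun j G hG => ?_
    have hKj := isHermitian_of_stein hX (hA j) (hK j)
    have hid := deriv_quadratic_eq hX h.isUnit hKj hKB hG hQY (hLj j)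
    have hj := (S.hasDerivAt_jet_snd_fst hY hL V₀ j).unique (hasDerivAt_pi.1 hd3 j)
    rw [hid, Matrix.add_mulVec, dotProduct_add, ← star_dotProduct_mulVec, Complex.add_re] at hj
    have e : star ((1 - S.X a₀) ^ 2 *ᵥ V₀) ⬝ᵥ G *ᵥ ((1 - S.X a₀) ^ 2 *ᵥ V₀) =
        star V₀ ⬝ᵥ (((1 - S.X a₀) ^ 2)ᴴ * G * (1 - S.X a₀) ^ 2) *ᵥ V₀ := by
      rw [Matrix.star_mulVec, ← Matrix.dotProduct_mulVec, Matrix.mulVec_mulVec,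
        Matrix.mulVec_mulVec, mul_assoc]
    rw [e]
    have h5 : ∀ z : ℂ, (star z).re = z.re := fun z => Complex.conj_re z
    rw [h5] at hj
    simp only [Pi.zero_apply] at hj
    linarith
  refine Prod.ext (funext fun j => ?_) rfl
  refine (hα j).trans ?_
  rw [show (α j).re = 0 from congrFun hre j]
  exact Complex.ofReal_zero

end JetDerivative

end

/-! ### The seven forms of the example. -/

noncomputable section

section Example

open scoped Topology

theorem exampleForms_isHermitian (j : Fin 7) : (exampleForms j).IsHermitian := by
  ext k l
  fin_cases j <;> fin_cases k <;> fin_cases l <;> simp [exampleForms]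

open scoped ComplexOrder in
-- Diagonal entries `m_k` of any matrix in the pencil satisfy `m₁ + m₂ + 2m₃ = 0`, so they cannot
-- all be positive.
theorem not_isStronglyPseudoconvex_exampleForms : ¬ IsStronglyPseudoconvex exampleForms := by
  rintro ⟨b, hb⟩
  have h0 := hb.diag_pos (i := 0)
  have h1 := hb.diag_pos (i := 1)
  have h2 := hb.diag_pos (i := 2)
  have hsum : pencil exampleForms b 0 0 + pencil exampleForms b 1 1 +
      (pencil exampleForms b 2 2 + pencil exampleForms b 2 2) = 0 := by
    simp [pencil, exampleForms, Fin.sum_univ_succ]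
    ring
  have := add_pos (add_pos h0 h1) (add_pos h2 h2)
  rw [hsum] at this
  exact lt_irrefl _ this

/-- `𝔇`-nondegeneracy forces `d ≤ 2n`. -/
theorem not_isDNondegenerate_of_lt {n d : ℕ} (h : 2 * n < d)
    (A : Fin d → Matrix (Fin n) (Fin n) ℂ) : ¬ IsDNondegenerate A := by
  rintro ⟨b, -, V, hV⟩
  set D := columnMatrix A V
  let f : (Fin d → ℝ) →ₗ[ℝ] (Fin n → ℂ) :=
    { toFun := fun v => D *ᵥ fun j => (v j : ℂ)
      map_add' := fun v w => by
        rw [← Matrix.mulVec_add]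
        congr 1
        ext j
        simp
      map_smul' := fun c v => by
        rw [RingHom.id_apply, ← Matrix.mulVec_smul]
        congr 1
        ext j
        simp }
  -- A real-linear map from `ℝᵈ` to `ℂⁿ` has a kernel when `d > 2n`, and the matrix in question
  -- factors through this map.
  have hker : f.ker ≠ ⊥ := LinearMap.ker_ne_bot_of_finrank_lt (by
    simp [Module.finrank_pi_fintype, Complex.finrank_real_complex]
    omega)
  obtain ⟨v, hv, hv0⟩ := (Submodule.ne_bot_iff _).1 hker
  refine hv0 (Matrix.mulVec_injective_of_isUnit hV ?_)
  rw [Matrix.mulVec_zero]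
  ext j
  have h1 : ((Dᴴ * (pencil A b)⁻¹ * D) *ᵥ fun j => (v j : ℂ)) = 0 := by
    rw [← Matrix.mulVec_mulVec]
    have : D *ᵥ (fun j => (v j : ℂ)) = 0 := hv
    rw [this, Matrix.mulVec_zero]
  have h2 := congrArg Complex.re (congrFun h1 j)
  simpa [Matrix.mulVec, dotProduct] using h2

/-! ### The nondegeneracy of a perturbed Gram matrix -/

/-- The `4 × 4` linear system governing the real symmetric forms. The entries of `p` are
`y², θ₁₁, θ₁₃, θ₃₃, κ₁₁, κ₃₃, κ₁₃, u₁, u₃, δ₁, δ₃`. -/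
def symmetricBlock (p : Fin 11 → ℝ) : Matrix (Fin 4) (Fin 4) ℝ :=
  let e := (2 + p 5 * p 8 ^ 2) * p 4 * p 7 ^ 2
  let f := (1 + p 4 * p 7 ^ 2) * p 5 * p 8 ^ 2
  !![p 9 * p 7 * p 4 + p 7, p 9 * p 7 * p 4 - p 7, p 7 * p 8 + p 0 * p 7 * p 2 * p 8,
      p 9 + p 7 ^ 2 + p 0 * p 7 ^ 2 * p 1;
    (1 + p 4 * p 7 ^ 2) - p 0 * p 4 ^ 2 * p 7 ^ 2 * p 9 * p 1,
      -(1 + p 4 * p 7 ^ 2) - p 0 * p 4 ^ 2 * p 7 ^ 2 * p 9 * p 1,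
      (1 + p 4 * p 7 ^ 2) * p 8 + p 0 * p 4 * p 7 ^ 2 * p 2 * p 8,
      (1 + p 4 * p 7 ^ 2) * p 7 + p 0 * p 4 * p 7 ^ 3 * p 1;
    p 8 - p 10 * p 8 * p 5, -p 8, p 8 ^ 2 + p 0 * p 8 ^ 2 * p 3 + p 10,
      p 8 * p 7 + p 0 * p 8 * p 2 * p 7;
    e * p 9 * p 1 * p 4 + f * p 10 * p 3 * p 5, e * p 9 * p 1 * p 4,
      -e * p 2 * p 8 + f * p 3 * p 8, -e * p 1 * p 7 + f * p 2 * p 7]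

/-- The `3 × 3` linear system governing the imaginary antisymmetric forms. -/
def antisymmetricBlock (p : Fin 11 → ℝ) : Matrix (Fin 3) (Fin 3) ℝ :=
  !![p 9 + p 7 ^ 2 + p 0 * p 7 ^ 2 * p 1, p 9 * p 8, -(p 7 * p 8) - p 0 * p 7 * p 2 * p 8;
    -(p 7 * p 8) - p 0 * p 8 * p 2 * p 7, p 10 * p 7, p 8 ^ 2 + p 0 * p 8 ^ 2 * p 3 + p 10;
    p 7 * p 8 * (-p 1 * p 7 + p 2 * p 7), p 9 * p 3 * p 8 ^ 2 + p 10 * p 1 * p 7 ^ 2,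
      p 7 * p 8 * (p 2 * p 8 - p 3 * p 8)]

/-- The limit of the perturbation parameters. -/
def limitPoint : Fin 11 → ℝ := ![0, 4, 2, 1, 1, 1, 1, 1, 1, 1, -1]

theorem eventually_det_symmetricBlock_ne_zero :
    ∀ᶠ p in 𝓝 limitPoint, (symmetricBlock p).det ≠ 0 := by
  have hc : Continuous fun p => (symmetricBlock p).det := by
    refine Continuous.matrix_det (continuous_matrix fun i j => ?_)
    fin_cases i <;> fin_cases j <;> simp [symmetricBlock] <;> fun_prop
  refine hc.continuousAt.eventually_ne ?_
  simp [symmetricBlock, limitPoint, Matrix.det_succ_row_zero, Fin.sum_univ_succ, Fin.succAbove]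
  norm_num

theorem eventually_det_antisymmetricBlock_ne_zero :
    ∀ᶠ p in 𝓝 limitPoint, (antisymmetricBlock p).det ≠ 0 := by
  have hc : Continuous fun p => (antisymmetricBlock p).det := by
    refine Continuous.matrix_det (continuous_matrix fun i j => ?_)
    fin_cases i <;> fin_cases j <;> simp [antisymmetricBlock] <;> fun_prop
  refine hc.continuousAt.eventually_ne ?_
  simp [antisymmetricBlock, limitPoint, Matrix.det_fin_three]
  norm_num

/-- The weights `U_k U_l (1 + y² θ_{kl})`. -/
def gramWeight (p : Fin 11 → ℝ) : Matrix (Fin 3) (Fin 3) ℝ :=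
  !![p 7 ^ 2 * (1 + p 0 * p 1), p 7, p 7 * p 8 * (1 + p 0 * p 2);
    p 7, 1, p 8;
    p 7 * p 8 * (1 + p 0 * p 2), p 8, p 8 ^ 2 * (1 + p 0 * p 3)]

/-- The forms `A_j` with the entry `(k, l)` multiplied by `κ_{kl}`. -/
def weightedForm (p : Fin 11 → ℝ) (j : Fin 7) : Matrix (Fin 3) (Fin 3) ℂ :=
  Matrix.of fun k l => ((!![p 4, 1, p 6; 1, 1, 1; p 6, 1, p 5] : Matrix _ _ ℝ) k l : ℂ) *
    exampleForms j k l

/-- The diagonal matrix with entries `δ_k`. -/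
def middleWeight (p : Fin 11 → ℝ) : Matrix (Fin 3) (Fin 3) ℂ :=
  Matrix.diagonal ![(p 9 : ℂ), 1, (p 10 : ℂ)]

theorem sum_smul_weightedForm (p : Fin 11 → ℝ) (α : Fin 7 → ℝ) :
    ∑ s, (α s : ℂ) • weightedForm p s =
      !![(p 4 * (α 0 + α 1) : ℂ), α 3 - Complex.I * α 6, -(Complex.I * (p 6 * α 4));
        α 3 + Complex.I * α 6, (α 0 - α 1 : ℂ), α 2 - Complex.I * α 5;
        Complex.I * (p 6 * α 4), α 2 + Complex.I * α 5, -(p 5 * α 0 : ℂ)] := by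
  ext k l
  fin_cases k <;> fin_cases l <;>
    simp [weightedForm, exampleForms, Fin.sum_univ_succ, Matrix.sum_apply] <;> ring

/-- The pairing of `A_j` with `∑ α_s A_s`. -/
def gramPairing (p : Fin 11 → ℝ) (α : Fin 7 → ℝ) (j : Fin 7) : ℝ :=
  (∑ k, ∑ l, (gramWeight p k l : ℂ) *
    (weightedForm p j * middleWeight p * ∑ s, (α s : ℂ) • weightedForm p s) k l).re

/-- All weights are real, so the real symmetric forms (`j = 0, …, 3`) and the imaginary
antisymmetric ones decouple. When `y² = p 0` is zero the weight is `U Uᵗ`, and each family contains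
a nonzero combination annihilating `U = (p 7, 1, p 8)`. That combination of equations is divisible
by `p 0`; its quotient is the last row of the block, and the block is invertible near the limit. -/
theorem eventually_gramPairing_nondegenerate :
    ∀ᶠ p in 𝓝 limitPoint, p 0 ≠ 0 → ∀ α : Fin 7 → ℝ, (∀ j, gramPairing p α j = 0) → α = 0 := by
  have h6 : ∀ᶠ p in 𝓝 limitPoint, p 6 ≠ 0 :=
    (continuous_apply (6 : Fin 11)).continuousAt.eventually_ne (by simp [limitPoint])
  filter_upwards [eventually_det_symmetricBlock_ne_zero, eventually_det_antisymmetricBlock_ne_zero,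
    h6] with p hs ha h6 h0 α h
  simp only [gramPairing, sum_smul_weightedForm] at h
  have e0 := h 0
  have e1 := h 1
  have e2 := h 2
  have e3 := h 3
  have e4 := h 4
  have e5 := h 5
  have e6 := h 6
  simp [gramWeight, weightedForm, middleWeight, exampleForms, Fin.sum_univ_three,
    Matrix.mul_apply, Matrix.diagonal, pow_two] at e0 e1 e2 e3 e4 e5 e6
  have hsym : symmetricBlock p *ᵥ ![α 0, α 1, α 2, α 3] = 0 := by
    ext i
    fin_cases i
    · simp [symmetricBlock, Matrix.mulVec, dotProduct, Fin.sum_univ_succ]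
      linear_combination e3
    · simp [symmetricBlock, Matrix.mulVec, dotProduct, Fin.sum_univ_succ]
      linear_combination p 4 * p 7 * e3 - e1
    · simp [symmetricBlock, Matrix.mulVec, dotProduct, Fin.sum_univ_succ]
      linear_combination e2
    · simp [symmetricBlock, Matrix.mulVec, dotProduct, Fin.sum_univ_succ]
      refine (mul_eq_zero.1 ?_).resolve_left h0
      -- Applied to `U`, the forms `p₅p₈A₂ + A₀ - A₁` and `p₄p₇A₃ - A₁` (weighted, indexed from `0`)
      -- give `(2 + p₅p₈²)` and `(1 + p₄p₇²)` times the second basis vector. This combination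
      -- cancels them.
      linear_combination (1 + p 4 * p 7 ^ 2) * (p 5 * p 8 * e2 + e0 - e1) -
        (2 + p 5 * p 8 ^ 2) * (p 4 * p 7 * e3 - e1)
  have hanti : antisymmetricBlock p *ᵥ ![α 6, p 6 * α 4, α 5] = 0 := by
    ext i
    fin_cases i
    · simp [antisymmetricBlock, Matrix.mulVec, dotProduct, Fin.sum_univ_succ]
      linear_combination e6
    · simp [antisymmetricBlock, Matrix.mulVec, dotProduct, Fin.sum_univ_succ]
      linear_combination e5
    · simp [antisymmetricBlock, Matrix.mulVec, dotProduct, Fin.sum_univ_succ]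
      refine (mul_eq_zero.1 ?_).resolve_left (mul_ne_zero h6 h0)
      -- The weighted form `A₄ - p₆p₈A₆ - p₆p₇A₅`, indexed from `0`, annihilates `U`.
      linear_combination e4 - p 6 * p 8 * e6 - p 6 * p 7 * e5
  have hs' := Matrix.eq_zero_of_mulVec_eq_zero hs hsym
  have ha' := Matrix.eq_zero_of_mulVec_eq_zero ha hanti
  have hs0 := congrFun hs' 0
  have hs1 := congrFun hs' 1
  have hs2 := congrFun hs' 2
  have hs3 := congrFun hs' 3
  have ha0 := congrFun ha' 0
  have ha1 := congrFun ha' 1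
  have ha2 := congrFun ha' 2
  simp [h6] at hs0 hs1 hs2 hs3 ha0 ha1 ha2
  ext j
  fin_cases j <;> simp [*]

end Example

end

/-! ### The diagonal solution and its perturbation parameters. -/

noncomputable section

section Example

open scoped Topology Matrix.Norms.L2Operator

/-- The small root of `t r² + r + t = 0`. -/
def smallRoot (t : ℝ) : ℝ := -2 * t / (1 + √(1 - 4 * t ^ 2))

theorem one_add_sqrt_pos (s : ℝ) : 0 < 1 + √s := by positivity

/-- The rationalized form of the root has no `t` in the denominator, so it is continuous through `t
= 0`. -/
theorem continuous_smallRoot : Continuous smallRoot := by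
  unfold smallRoot
  exact Continuous.div (by fun_prop) (by fun_prop) fun t => (one_add_sqrt_pos _).ne'

theorem smallRoot_eq {t : ℝ} (ht : 4 * t ^ 2 ≤ 1) :
    t * smallRoot t ^ 2 + smallRoot t + t = 0 := by
  have h1 := (one_add_sqrt_pos (1 - 4 * t ^ 2)).ne'
  have h2 := Real.sq_sqrt (show 0 ≤ 1 - 4 * t ^ 2 by linarith)
  rw [smallRoot]
  generalize √(1 - 4 * t ^ 2) = s at *
  field_simp
  linear_combination t * h2

/-- The quotient of the small roots for `2ε` and `ε`. -/
def rootRatio (ε : ℝ) : ℝ := 2 * (1 + √(1 - 4 * ε ^ 2)) / (1 + √(1 - 4 * (2 * ε) ^ 2))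

theorem continuous_rootRatio : Continuous rootRatio := by
  unfold rootRatio
  exact Continuous.div (by fun_prop) (by fun_prop) fun t => (one_add_sqrt_pos _).ne'

/-- Here `x` and `y` are the small roots for `2ε` and `ε`. Writing `x = ρy` with `ρ` continuous at
`0` lets `y²` be factored out of every `x_k x_l`. -/
theorem smallRoot_two_mul (ε : ℝ) : smallRoot (2 * ε) = rootRatio ε * smallRoot ε := by
  have h1 := (one_add_sqrt_pos (1 - 4 * ε ^ 2)).ne'
  have h2 := (one_add_sqrt_pos (1 - 4 * (2 * ε) ^ 2)).ne'
  rw [smallRoot, smallRoot, rootRatio]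
  field_simp

theorem smallRoot_ne_zero {ε : ℝ} (h : ε ≠ 0) : smallRoot ε ≠ 0 :=
  div_ne_zero (by simpa using h) (one_add_sqrt_pos _).ne'

/-- The diagonal entries of the solution `X`. -/
def diagEntries (x y : ℝ) : Fin 3 → ℝ := ![x, 0, y]

/-- The diagonal solution `X`. -/
def diagSolution (x y : ℝ) : Matrix (Fin 3) (Fin 3) ℂ :=
  Matrix.diagonal fun k => (diagEntries x y k : ℂ)

theorem abs_diagEntries_lt {x y : ℝ} (hx : |x| < 1) (hy : |y| < 1) (k : Fin 3) :
    |diagEntries x y k| < 1 := by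
  fin_cases k <;> simp [diagEntries, hx, hy]

theorem abs_diagEntries_mul_lt {x y : ℝ} (hx : |x| < 1) (hy : |y| < 1) (k l : Fin 3) :
    |diagEntries x y k * diagEntries x y l| < 1 := by
  rw [abs_mul]
  exact mul_lt_one_of_nonneg_of_lt_one_left (abs_nonneg _) (abs_diagEntries_lt hx hy k)
    (abs_diagEntries_lt hx hy l).le

theorem one_sub_diagEntries_mul_ne_zero {x y : ℝ} (hx : |x| < 1) (hy : |y| < 1) (k l : Fin 3) :
    1 - diagEntries x y k * diagEntries x y l ≠ 0 := by
  have := (abs_lt.1 (abs_diagEntries_mul_lt hx hy k l)).2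
  linarith

theorem norm_diagSolution_lt {x y : ℝ} (hx : |x| < 1) (hy : |y| < 1) : ‖diagSolution x y‖ < 1 := by
  rw [diagSolution, Matrix.l2_opNorm_diagonal, pi_norm_lt_iff one_pos]
  intro k
  simpa using abs_diagEntries_lt hx hy k

/-- The perturbation parameters of the matrix `DaMatrix`. -/
def seriesPoint (t : ℝ × ℝ × ℝ) : Fin 11 → ℝ :=
  ![t.2.1 ^ 2, t.2.2 ^ 2 / (1 - t.1 * t.1), t.2.2 / (1 - t.1 * t.2.1), 1 / (1 - t.2.1 * t.2.1),
    1, 1, 1, 1, 1, 1, -1]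

/-- The perturbation parameters of the derivative of the `1`-jet map. -/
def jetPoint (t : ℝ × ℝ × ℝ) : Fin 11 → ℝ :=
  ![t.2.1 ^ 2, t.2.2 ^ 2 / (1 - t.1 * t.1), t.2.2 / (1 - t.1 * t.2.1), 1 / (1 - t.2.1 * t.2.1),
    1 / (1 - t.1 * t.1), 1 / (1 - t.2.1 * t.2.1), 1 / (1 - t.1 * t.2.1),
    (1 - t.1) ^ 2, (1 - t.2.1) ^ 2, 1 + t.1 ^ 2, -(1 + t.2.1 ^ 2)]

theorem tendsto_seriesPoint : Filter.Tendsto seriesPoint (𝓝 (0, 0, 2)) (𝓝 limitPoint) := by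
  have hc : ContinuousAt seriesPoint (0, 0, 2) := by
    refine continuousAt_pi.2 fun i => ?_
    fin_cases i <;> simp [seriesPoint] <;> fun_prop (disch := simp)
  have h0 : seriesPoint (0, 0, 2) = limitPoint := by
    ext i; fin_cases i <;> simp [seriesPoint, limitPoint]; norm_num
  rw [← h0]
  exact hc

theorem tendsto_jetPoint : Filter.Tendsto jetPoint (𝓝 (0, 0, 2)) (𝓝 limitPoint) := by
  have hc : ContinuousAt jetPoint (0, 0, 2) := by
    refine continuousAt_pi.2 fun i => ?_
    fin_cases i <;> simp [jetPoint] <;> fun_prop (disch := simp)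
  have h0 : jetPoint (0, 0, 2) = limitPoint := by
    ext i; fin_cases i <;> simp [jetPoint, limitPoint]; norm_num
  rw [← h0]
  exact hc

section

variable {x y ρ : ℝ}

/-- Since `1/(1 - c) = 1 + c/(1 - c)` and each `c = x_k x_l` is `y²` times `ρ²`, `ρ`, `1` or `0`,
the `θ_kl` of `seriesPoint` are the remaining factors. -/
theorem gramWeight_seriesPoint (hx : |x| < 1) (hy : |y| < 1) (hρ : x = ρ * y) (k l : Fin 3) :
    gramWeight (seriesPoint (x, y, ρ)) k l =
      (1 - diagEntries x y k * diagEntries x y l)⁻¹ := by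
  have h1 : 1 - x * x ≠ 0 := one_sub_diagEntries_mul_ne_zero hx hy 0 0
  have h2 : 1 - x * y ≠ 0 := one_sub_diagEntries_mul_ne_zero hx hy 0 2
  have h3 : 1 - y * y ≠ 0 := one_sub_diagEntries_mul_ne_zero hx hy 2 2
  have aux : ∀ c D : ℝ, D ≠ 0 → c = 1 - D → 1 + c / D = D⁻¹ := by
    rintro c D hD rfl
    field_simp
    ring
  have e1 : 1 + y ^ 2 * (ρ ^ 2 / (1 - x * x)) = (1 - x * x)⁻¹ := by
    rw [← mul_div_assoc]; exact aux _ _ h1 (by rw [hρ]; ring)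
  have e2 : 1 + y ^ 2 * (ρ / (1 - x * y)) = (1 - x * y)⁻¹ := by
    rw [← mul_div_assoc]; exact aux _ _ h2 (by rw [hρ]; ring)
  have e3 : 1 + y ^ 2 * (1 - y * y)⁻¹ = (1 - y * y)⁻¹ := by
    rw [← div_eq_mul_inv]; exact aux _ _ h3 (by ring)
  fin_cases k <;> fin_cases l <;>
    simp [gramWeight, seriesPoint, diagEntries, e1, e2, e3, mul_comm y x]

/-- The diagonal entries of `(I - X)²`. -/
def squareEntries (x y : ℝ) (k : Fin 3) : ℝ := (1 - diagEntries x y k) ^ 2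

theorem gramWeight_jetPoint (hx : |x| < 1) (hy : |y| < 1) (hρ : x = ρ * y) (k l : Fin 3) :
    gramWeight (jetPoint (x, y, ρ)) k l = squareEntries x y k * squareEntries x y l *
      (1 - diagEntries x y k * diagEntries x y l)⁻¹ := by
  rw [← gramWeight_seriesPoint hx hy hρ]
  fin_cases k <;> fin_cases l <;>
    simp [gramWeight, seriesPoint, jetPoint, squareEntries, diagEntries, -mul_eq_mul_right_iff,
      -mul_eq_mul_left_iff] <;> ring

theorem weightedForm_jetPoint (j : Fin 7) (k l : Fin 3) :
    weightedForm (jetPoint (x, y, ρ)) j k l =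
      (((1 - diagEntries x y k * diagEntries x y l)⁻¹ : ℝ) : ℂ) * exampleForms j k l := by
  rw [weightedForm, Matrix.of_apply]
  congr 2
  fin_cases k <;> fin_cases l <;> simp [jetPoint, diagEntries, mul_comm y x]

theorem weightedForm_seriesPoint (j : Fin 7) :
    weightedForm (seriesPoint (x, y, ρ)) j = exampleForms j := by
  ext k l
  rw [weightedForm, Matrix.of_apply]
  fin_cases k <;> fin_cases l <;> simp [seriesPoint]

/-- For diagonal `X` the Stein operator acts entrywise. Hence the `K_j` are the `A_j` with entries
divided by `1 - x_k x_l`. -/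
theorem stein_diagSolution_apply (Z : Matrix (Fin 3) (Fin 3) ℂ) (k l : Fin 3) :
    stein (diagSolution x y) Z k l =
      ((1 - diagEntries x y k * diagEntries x y l : ℝ) : ℂ) * Z k l := by
  rw [stein_apply, diagSolution, Matrix.diagonal_conjTranspose, Matrix.sub_apply,
    Matrix.mul_diagonal, Matrix.diagonal_mul]
  simp
  ring

theorem stein_weightedForm (hx : |x| < 1) (hy : |y| < 1) (j : Fin 7) :
    stein (diagSolution x y) (weightedForm (jetPoint (x, y, ρ)) j) = exampleForms j := by
  ext k l
  rw [stein_diagSolution_apply, weightedForm_jetPoint, ← mul_assoc, ← Complex.ofReal_mul,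
    mul_inv_cancel₀ (one_sub_diagEntries_mul_ne_zero hx hy k l), Complex.ofReal_one, one_mul]

/-- Each entry contributes a geometric series of ratio `x_k x_l`. -/
theorem tsum_diagSolution (hx : |x| < 1) (hy : |y| < 1) (hρ : x = ρ * y)
    (N : Matrix (Fin 3) (Fin 3) ℂ) :
    ∑' r : ℕ, star (diagSolution x y ^ r *ᵥ ![1, 1, 1]) ⬝ᵥ
      N *ᵥ (diagSolution x y ^ r *ᵥ ![1, 1, 1]) =
    ∑ k, ∑ l, (gramWeight (seriesPoint (x, y, ρ)) k l : ℂ) * N k l := by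
  have hterm : ∀ r : ℕ, star (diagSolution x y ^ r *ᵥ ![1, 1, 1]) ⬝ᵥ
      N *ᵥ (diagSolution x y ^ r *ᵥ ![1, 1, 1]) =
      ∑ k, ∑ l, ((diagEntries x y k * diagEntries x y l : ℝ) : ℂ) ^ r * N k l := by
    intro r
    have hv : diagSolution x y ^ r *ᵥ ![1, 1, 1] = fun k => (diagEntries x y k : ℂ) ^ r := by
      ext k
      rw [diagSolution, Matrix.diagonal_pow, Matrix.mulVec_diagonal]
      fin_cases k <;> simp
    rw [hv]
    simp only [dotProduct, Matrix.mulVec, Finset.mul_sum]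
    refine Finset.sum_congr rfl fun k _ => Finset.sum_congr rfl fun l _ => ?_
    simp
    ring
  simp_rw [hterm]
  refine HasSum.tsum_eq (hasSum_sum fun k _ => hasSum_sum fun l _ => ?_)
  rw [gramWeight_seriesPoint hx hy hρ]
  have := (hasSum_geometric_of_norm_lt_one (K := ℂ)
    (ξ := ((diagEntries x y k * diagEntries x y l : ℝ) : ℂ))
    (by rw [Complex.norm_real]; exact abs_diagEntries_mul_lt hx hy k l)).mul_right (N k l)
  simpa using this

theorem gramPairing_eq_sum (p : Fin 11 → ℝ) (α : Fin 7 → ℝ) (j : Fin 7) :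
    gramPairing p α j = ∑ s, (∑ k, ∑ l, (gramWeight p k l : ℂ) *
      (weightedForm p j * middleWeight p * weightedForm p s) k l).re * α s := by
  have : (∑ k, ∑ l, (gramWeight p k l : ℂ) *
      (weightedForm p j * middleWeight p * ∑ s, (α s : ℂ) • weightedForm p s) k l) =
      ∑ s, (∑ k, ∑ l, (gramWeight p k l : ℂ) *
        (weightedForm p j * middleWeight p * weightedForm p s) k l) * (α s : ℂ) := by
    simp_rw [Matrix.mul_sum, Matrix.sum_apply, Matrix.mul_smul, Matrix.smul_apply, Finset.sum_mul,
      Finset.mul_sum]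
    symm
    rw [Finset.sum_comm]
    refine Finset.sum_congr rfl fun k _ => ?_
    rw [Finset.sum_comm]
    refine Finset.sum_congr rfl fun l _ => Finset.sum_congr rfl fun s _ => ?_
    rw [smul_eq_mul]
    ring
  rw [gramPairing, this, Complex.re_sum]
  refine Finset.sum_congr rfl fun s _ => ?_
  rw [Complex.re_mul_ofReal]

end

end Example

end

/-! ### The two nondegeneracy statements for the example. -/

noncomputable section

section Example

open scoped Topology Matrix.Norms.L2Operator

section

variable (ε : ℝ)

theorem coeffP_example : coeffP exampleForms ![(ε : ℂ), (ε : ℂ), 0, 0, 0, 0, 0] =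
    Matrix.diagonal ![2 * (ε : ℂ), 0, -(ε : ℂ)] := by
  ext k l
  fin_cases k <;> fin_cases l <;>
    simp [coeffP, exampleForms, Fin.sum_univ_succ, Matrix.diagonal]
  ring

theorem coeffA_example : coeffA exampleForms ![1 + 2 * ε, 2 * ε, 0, 0, 0, 0, 0]
    ![(ε : ℂ), (ε : ℂ), 0, 0, 0, 0, 0] = Matrix.diagonal ![1, 1, -1] := by
  ext k l
  fin_cases k <;> fin_cases l <;>
    simp [coeffA, exampleForms, Fin.sum_univ_succ, Matrix.diagonal] <;> ring

end

theorem coeffA_example_mul (ε : ℝ) : coeffA exampleForms ![1 + 2 * ε, 2 * ε, 0, 0, 0, 0, 0]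
    ![(ε : ℂ), (ε : ℂ), 0, 0, 0, 0, 0] * Matrix.diagonal ![1, 1, -1] = 1 := by
  rw [coeffA_example, Matrix.diagonal_mul_diagonal, ← Matrix.diagonal_one]
  congr 1
  ext k
  fin_cases k <;> simp

variable {ε x y ρ : ℝ}

/-- The root equations give `1 + 2εx = 1/(1 + x²)` and `1 + εy = 1/(1 + y²)`, so `Q⁻¹ = diag(1 + x²,
1, -(1 + y²))`. -/
theorem middle_example_mul (hx : 2 * ε * x ^ 2 + x + 2 * ε = 0) (hy : ε * y ^ 2 + y + ε = 0) :
    middle exampleForms ![1 + 2 * ε, 2 * ε, 0, 0, 0, 0, 0] ![(ε : ℂ), (ε : ℂ), 0, 0, 0, 0, 0]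
      (diagSolution x y) * middleWeight (jetPoint (x, y, ρ)) = 1 := by
  have hx' : (2 * ε * x ^ 2 + x + 2 * ε : ℂ) = 0 := by exact_mod_cast hx
  have hy' : (ε * y ^ 2 + y + ε : ℂ) = 0 := by exact_mod_cast hy
  rw [middle, coeffA_example, coeffP_example, diagSolution, middleWeight,
    Matrix.diagonal_mul_diagonal, Matrix.diagonal_add, Matrix.diagonal_mul_diagonal,
    ← Matrix.diagonal_one]
  congr 1
  ext k
  fin_cases k
  · simp [diagEntries, jetPoint]
    linear_combination x * hx'
  · simp [diagEntries]
  · simp [diagEntries, jetPoint]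
    linear_combination y * hy'

theorem isRegularSolution_example (hx1 : |x| < 1) (hy1 : |y| < 1)
    (hx : 2 * ε * x ^ 2 + x + 2 * ε = 0) (hy : ε * y ^ 2 + y + ε = 0) :
    IsRegularSolution exampleForms ![1 + 2 * ε, 2 * ε, 0, 0, 0, 0, 0]
      ![(ε : ℂ), (ε : ℂ), 0, 0, 0, 0, 0] (diagSolution x y) where
  eq := by
    have hx' : (2 * ε * x ^ 2 + x + 2 * ε : ℂ) = 0 := by exact_mod_cast hx
    have hy' : (ε * y ^ 2 + y + ε : ℂ) = 0 := by exact_mod_cast hy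
    rw [coeffA_example, coeffP_example, diagSolution, Matrix.diagonal_pow,
      Matrix.diagonal_mul_diagonal, Matrix.diagonal_mul_diagonal, Matrix.diagonal_add,
      Matrix.diagonal_conjTranspose, Matrix.diagonal_add, ← Matrix.diagonal_zero]
    congr 1
    ext k
    fin_cases k
    · simp [diagEntries]
      linear_combination hx'
    · simp [diagEntries]
    · simp [diagEntries]
      linear_combination -hy'
  norm_lt := norm_diagSolution_lt hx1 hy1
  isUnit := by
    have := middle_example_mul (ρ := 0) hx hy
    exact (Matrix.isUnit_iff_isUnit_det _).2 (Matrix.isUnit_det_of_right_inverse this)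

theorem isDaNondegenerateAt_example (hx1 : |x| < 1) (hy1 : |y| < 1)
    (hx : 2 * ε * x ^ 2 + x + 2 * ε = 0) (hy : ε * y ^ 2 + y + ε = 0) (hρ : x = ρ * y)
    (hnd : ∀ α : Fin 7 → ℝ, (∀ j, gramPairing (seriesPoint (x, y, ρ)) α j = 0) → α = 0) :
    IsDaNondegenerateAt exampleForms ![1 + 2 * ε, 2 * ε, 0, 0, 0, 0, 0]
      ![(ε : ℂ), (ε : ℂ), 0, 0, 0, 0, 0] ![1, 1, 1] := by
  have hr := isRegularSolution_example hx1 hy1 hx hy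
  refine ⟨?_, ?_, diagSolution x y, hr.isSmallSolution exampleForms_isHermitian, ?_⟩
  · rw [pencil_eq exampleForms_isHermitian hr.eq hr.norm_lt]
    have hu := isUnit_one_sub hr.norm_lt
    exact (hu.star.mul hr.isUnit).mul hu
  · exact (Matrix.isUnit_iff_isUnit_det _).2
      (Matrix.isUnit_det_of_right_inverse (coeffA_example_mul ε))
  · rw [← Matrix.mulVec_injective_iff_isUnit]
    refine (injective_iff_map_eq_zero (Matrix.mulVecLin _)).2 fun α h0 => hnd α fun j => ?_
    rw [gramPairing_eq_sum]
    refine Eq.trans ?_ (congrFun h0 j)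
    rw [Matrix.mulVecLin_apply, Matrix.mulVec, dotProduct]
    refine Finset.sum_congr rfl fun s _ => ?_
    congr 1
    rw [DaMatrix, Matrix.of_apply, tsum_diagSolution hx1 hy1 hρ, weightedForm_seriesPoint,
      weightedForm_seriesPoint, Matrix.inv_eq_right_inv (coeffA_example_mul ε)]
    congr! 8
    rw [middleWeight]
    congr 1
    ext k
    fin_cases k <;> simp [seriesPoint]

/-- Solving the Stein equation for `G` divides the entry `(k, l)` by `1 - x_k x_l`. Together with
the entries of `U = (1 - X)² V` this is the weight at `jetPoint`, so `Re U* G U` is `gramPairing`.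
-/
theorem oneJetIsLocalDiffeoAt_example (hx1 : |x| < 1) (hy1 : |y| < 1)
    (hx : 2 * ε * x ^ 2 + x + 2 * ε = 0) (hy : ε * y ^ 2 + y + ε = 0) (hρ : x = ρ * y)
    (hnd : ∀ α : Fin 7 → ℝ, (∀ j, gramPairing (jetPoint (x, y, ρ)) α j = 0) → α = 0) :
    OneJetIsLocalDiffeoAt exampleForms ![1 + 2 * ε, 2 * ε, 0, 0, 0, 0, 0]
      (![(ε : ℂ), (ε : ℂ), 0, 0, 0, 0, 0], ![1, 1, 1]) := by
  have hr := isRegularSolution_example hx1 hy1 hx hy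
  refine oneJetIsLocalDiffeoAt_of_regular exampleForms_isHermitian hr
    (stein_weightedForm (ρ := ρ) hx1 hy1) (fun h => by simpa using congrFun h 0)
    fun α h0 => hnd α fun j => ?_
  obtain ⟨G, hG⟩ := stein_surjective hr.norm_lt (weightedForm (jetPoint (x, y, ρ)) j *
    middleWeight (jetPoint (x, y, ρ)) * ∑ s, (α s : ℂ) • weightedForm (jetPoint (x, y, ρ)) s)
  rw [← h0 j G (by rw [hG, Matrix.inv_eq_right_inv (middle_example_mul hx hy)]), gramPairing, ← hG]
  congr 1
  have hv : (1 - diagSolution x y) ^ 2 *ᵥ ![1, 1, 1] = fun k => (squareEntries x y k : ℂ) := by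
    ext k
    rw [diagSolution, ← Matrix.diagonal_one, Matrix.diagonal_sub, Matrix.diagonal_pow,
      Matrix.mulVec_diagonal]
    fin_cases k <;> simp [squareEntries]
  rw [hv]
  simp only [dotProduct, Matrix.mulVec, Finset.mul_sum]
  refine Finset.sum_congr rfl fun k _ => Finset.sum_congr rfl fun l _ => ?_
  have hne : (((1 - diagEntries x y k * diagEntries x y l : ℝ)) : ℂ) ≠ 0 := by
    exact_mod_cast one_sub_diagEntries_mul_ne_zero hx1 hy1 k l
  rw [stein_diagSolution_apply, gramWeight_jetPoint hx1 hy1 hρ, Complex.ofReal_mul,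
    Complex.ofReal_inv]
  generalize (((1 - diagEntries x y k * diagEntries x y l : ℝ)) : ℂ) = D at hne
  simp only [Pi.star_apply, Complex.star_def, Complex.conj_ofReal, Complex.ofReal_mul]
  field_simp

end Example

end

theorem theorem2p5 :
    ¬ IsStronglyPseudoconvex exampleForms ∧
    ¬ IsDNondegenerate exampleForms ∧
    ∃ ε₀ > (0 : ℝ), ∀ ε : ℝ, ε ≠ 0 → |ε| < ε₀ →
      IsDaNondegenerate exampleForms ![1 + 2 * ε, 2 * ε, 0, 0, 0, 0, 0]
          ![(ε : ℂ), (ε : ℂ), 0, 0, 0, 0, 0] ∧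
      IsDaNondegenerateAt exampleForms ![1 + 2 * ε, 2 * ε, 0, 0, 0, 0, 0]
          ![(ε : ℂ), (ε : ℂ), 0, 0, 0, 0, 0] ![1, 1, 1] ∧
      OneJetIsLocalDiffeoAt exampleForms ![1 + 2 * ε, 2 * ε, 0, 0, 0, 0, 0]
          (![(ε : ℂ), (ε : ℂ), 0, 0, 0, 0, 0], ![1, 1, 1]) := by
  refine ⟨not_isStronglyPseudoconvex_exampleForms,
    not_isDNondegenerate_of_lt (by norm_num) exampleForms, ?_⟩
  have hroot0 : smallRoot 0 = 0 := by simp [smallRoot]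
  have hratio0 : rootRatio 0 = 2 := by simp [rootRatio]
  have hcx : Continuous fun ε => smallRoot (2 * ε) := continuous_smallRoot.comp (by fun_prop)
  have hc : Filter.Tendsto (fun ε => (smallRoot (2 * ε), smallRoot ε, rootRatio ε)) (nhds 0)
      (nhds (0, 0, 2)) := by
    have := (hcx.prodMk (continuous_smallRoot.prodMk continuous_rootRatio)).tendsto 0
    simpa [hroot0, hratio0] using this
  have ev1 := (tendsto_seriesPoint.comp hc).eventually eventually_gramPairing_nondegenerate
  have ev2 := (tendsto_jetPoint.comp hc).eventually eventually_gramPairing_nondegenerate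
  have ev3 : ∀ᶠ ε in nhds (0 : ℝ), |smallRoot (2 * ε)| < 1 :=
    hcx.abs.continuousAt.eventually_lt continuousAt_const (by simp [hroot0])
  have ev4 : ∀ᶠ ε in nhds (0 : ℝ), |smallRoot ε| < 1 :=
    continuous_smallRoot.abs.continuousAt.eventually_lt continuousAt_const (by simp [hroot0])
  have ev5 : ∀ᶠ ε in nhds (0 : ℝ), 4 * (2 * ε) ^ 2 < 1 :=
    ContinuousAt.eventually_lt (by fun_prop) continuousAt_const (by simp)
  obtain ⟨ε₀, hε₀, H⟩ := Metric.eventually_nhds_iff.1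
    (ev1.and (ev2.and (ev3.and (ev4.and ev5))))
  refine ⟨ε₀, hε₀, fun ε hε hlt => ?_⟩
  obtain ⟨h1, h2, hx1, hy1, h5⟩ := H (y := ε) (by simpa using hlt)
  have hx : 2 * ε * smallRoot (2 * ε) ^ 2 + smallRoot (2 * ε) + 2 * ε = 0 := smallRoot_eq h5.le
  have hy : ε * smallRoot ε ^ 2 + smallRoot ε + ε = 0 := smallRoot_eq (by nlinarith)
  -- This is the condition `p 0 ≠ 0`, the only place where `ε ≠ 0` enters.
  have hy0 : smallRoot ε ^ 2 ≠ 0 := pow_ne_zero 2 (smallRoot_ne_zero hε)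
  have hDa := isDaNondegenerateAt_example hx1 hy1 hx hy (smallRoot_two_mul ε) (h1 hy0)
  exact ⟨⟨_, hDa⟩, hDa, oneJetIsLocalDiffeoAt_example hx1 hy1 hx hy (smallRoot_two_mul ε) (h2 hy0)⟩
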